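/- For a topological space $X$ and a family $\mathcal A$ of subsets of $X$, say that $X$ is $\mathcal A$-selectively pseudocompact ($\mathcal A$-SP) if for every sequence $\langle U_n : n\in\omega\rangle$ of non-empty open subsets of $X$ one can pick sets $A_n\in\mathcal A$ with $A_n\subseteq U_n$ such that the family $\langle A_n : n\in\omega\rangle$ is not locally finite, i.e. there is a point of $X$ every neighbourhood of which meets $A_n$ for infinitely many $n$. A subset of $X$ is scattered if each of its non-empty subsets has a relatively isolated point. Let $\mathrm{Nwd}_\omega(X)$ and $\mathrm{Scat}_\omega(X)$ be the families of all countably infinite subsets of $X$ that are nowhere dense, respectively scattered. A space is crowded if it has no isolated points, and $0$-dimensional if its clopen sets form a base; $w(X)$ is the least cardinality of a base of $X$. **Theorem.** Assume the Continuum Hypothesis. 1. There is a crowded, $0$-dimensional Hausdorff space $X$ with $|X| = w(X) = \omega_1$ such that every countable discrete subspace of $X$ is closed in $X$ and $X$ is $\mathrm{Nwd}_\omega(X)$-SP. 2. Consequently, there is a crowded, $0$-dimensional Hausdorff space $X$ which is $\mathrm{Nwd}_\omega(X)$-SP but not $\mathrm{Scat}_\omega(X)$-SP. -/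

import Mathlib

open Set TopologicalSpace Cardinal

/-- The weight `w(X)`: the least cardinality of a base of the topology. -/
noncomputable def topWeight (X : Type*) [TopologicalSpace X] : Cardinal :=
  sInf {κ | ∃ B : Set (Set X), IsTopologicalBasis B ∧ #B = κ}

/-- A space is 0-dimensional if its clopen subsets form a base. -/
def ZeroDimensional (X : Type*) [TopologicalSpace X] : Prop :=
  IsTopologicalBasis {s : Set X | IsClopen s}

/-- A subset `S` of a space is scattered if every non-empty subset of `S` has a (relatively)
isolated point. -/
def IsScatteredSet {X : Type*} [TopologicalSpace X] (S : Set X) : Prop :=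
  ∀ T ⊆ S, T.Nonempty → ∃ x ∈ T, ∃ U : Set X, IsOpen U ∧ U ∩ T = {x}

/-- `Scat_ω(X)`: the countably infinite scattered subsets of `X`. -/
def ScatOmega (X : Type*) [TopologicalSpace X] : Set (Set X) :=
  {S | S.Countable ∧ S.Infinite ∧ IsScatteredSet S}

/-- `Nwd_ω(X)`: the countably infinite nowhere dense subsets of `X`. -/
def NwdOmega (X : Type*) [TopologicalSpace X] : Set (Set X) :=
  {S | S.Countable ∧ S.Infinite ∧ IsNowhereDense S}

/-- `X` is `𝒜`-selectively pseudocompact: for every sequence of non-empty open sets `U n` one can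
pick `A n ∈ 𝒜` with `A n ⊆ U n` such that the family `(A n)` is not locally finite, i.e. some
point of `X` has only neighbourhoods that meet `A n` for infinitely many `n`. -/
def SelectivelyPseudocompact {X : Type*} [TopologicalSpace X] (𝒜 : Set (Set X)) : Prop :=
  ∀ U : ℕ → Set X, (∀ n, IsOpen (U n)) → (∀ n, (U n).Nonempty) →
    ∃ A : ℕ → Set X, (∀ n, A n ∈ 𝒜 ∧ A n ⊆ U n) ∧ ¬ LocallyFinite A

/-! The space has `ω₁` points in the Cantor cube of weight `ω₁` and is a directed union of countable
approximations. Each consists of countably many points, countably many coordinates and countably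
many promises: certain sets stay closed discrete, and certain sequences of crowded nowhere dense
sets accumulate at certain points. Extensions add points, coordinates and promises, but never change
old values. Increasing sequences of approximations have upper bounds, and CH leaves only `ω₁`
requests (a sequence of points with basic neighbourhoods), so a directed family can meet them all.

Two extensions carry the argument. In `GoodFor.exists_refinement` a discrete sequence becomes closed
once a suitable open set `W` around it is declared clopen. Points of `W` keep their small
neighbourhoods. For points outside `W` the old properties need witnesses outside `W`, so `W` is made
to miss tails of countably many sequences of witnesses. These must avoid the discrete set, which is
possible because the accumulating sets are kept crowded and not merely infinite.

In `GoodFor.exists_insert_point` a sequence of crowded nowhere dense sets has a cluster point in the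
Cantor space. If no existing point sits there, a new one is added, with a new clopen set around it
thin enough to keep the old closed discrete sets from accumulating.

For the second claim, closedness of countable discrete sets makes countable scattered sets discrete.
Such sets, taken inside disjoint open sets, have a closed discrete union and hence form a locally
finite family. -/

/-! ### Neighbourhood relations and the properties to be preserved -/

section Relations

variable {Ω K L : Type*}

/-- Every point of `C` is `E`-approximated by other points of `C`. -/
def CrowdedFor (E : K → Ω → Ω → Prop) (C : Set Ω) : Prop :=
  ∀ x ∈ C, ∀ k, ∃ y ∈ C, y ≠ x ∧ E k x y

/-- `A` is nowhere dense in `X` with respect to the neighbourhoods given by `E`. -/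
def NowhereDenseFor (E : K → Ω → Ω → Prop) (X A : Set Ω) : Prop :=
  ∀ x ∈ X, ∀ k, ∃ y ∈ X, E k x y ∧ ∃ l, ∀ z ∈ A, ¬ E l y z

/-- Every `E`-neighbourhood of `q` meets `A n` for infinitely many `n`. -/
def AccumulatesFor (E : K → Ω → Ω → Prop) (q : Ω) (A : ℕ → Set Ω) : Prop :=
  ∀ k m, ∃ n ≥ m, ∃ y ∈ A n, E k q y

/-- `D` is closed and discrete in `X` with respect to the neighbourhoods given by `E`. -/
def ClosedDiscreteFor (E : K → Ω → Ω → Prop) (X D : Set Ω) : Prop :=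
  ∀ x ∈ X, ∃ k, ∀ y ∈ D, E k x y → y = x

/-- The family `A` consists of countably infinite, crowded, nowhere dense subsets of `X` and accumulates
at `q ∈ X`. -/
structure AccumulationFor (E : K → Ω → Ω → Prop) (X : Set Ω) (q : Ω) (A : ℕ → Set Ω) : Prop where
  mem : q ∈ X
  subset : ∀ n, A n ⊆ X
  countable : ∀ n, (A n).Countable
  infinite : ∀ n, (A n).Infinite
  crowded : ∀ n, CrowdedFor E (A n)
  nowhereDense : ∀ n, NowhereDenseFor E X (A n)
  accumulates : AccumulatesFor E q A

/-- `E` makes `X` a crowded Hausdorff space in which the members of `𝒟` are closed discrete and the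
members of `𝒜` are accumulating families. -/
structure GoodFor (E : K → Ω → Ω → Prop) (X : Set Ω) (𝒟 : Set (Set Ω))
    (𝒜 : Set (Ω × (ℕ → Set Ω))) : Prop where
  nonempty : X.Nonempty
  separated : ∀ x ∈ X, ∀ y ∈ X, x ≠ y → ∃ k, ¬ E k x y
  crowded : CrowdedFor E X
  closedDiscrete : ∀ D ∈ 𝒟, D ⊆ X ∧ ClosedDiscreteFor E X D
  accumulation : ∀ a ∈ 𝒜, AccumulationFor E X a.1 a.2

theorem AccumulationFor.transfer {E : K → Ω → Ω → Prop} {E' : L → Ω → Ω → Prop} {X : Set Ω}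
    {q : Ω} {A : ℕ → Set Ω} (h : AccumulationFor E X q A)
    (h₁ : ∀ k, ∃ l, ∀ x ∈ X, ∀ y ∈ X, E' l x y → E k x y)
    (h₂ : ∀ l, ∃ k, ∀ x ∈ X, ∀ y ∈ X, E k x y → E' l x y) : AccumulationFor E' X q A where
  mem := h.mem
  subset := h.subset
  countable := h.countable
  infinite := h.infinite
  crowded n x hx l := by
    obtain ⟨k, hk⟩ := h₂ l
    obtain ⟨y, hy, hyx, hE⟩ := h.crowded n x hx k
    exact ⟨y, hy, hyx, hk x (h.subset n hx) y (h.subset n hy) hE⟩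
  nowhereDense n x hx l := by
    obtain ⟨k, hk⟩ := h₂ l
    obtain ⟨y, hy, hE, k', hk'⟩ := h.nowhereDense n x hx k
    obtain ⟨l', hl'⟩ := h₁ k'
    exact ⟨y, hy, hk x hx y hy hE, l', fun z hz hz' => hk' z hz (hl' y hy z (h.subset n hz) hz')⟩
  accumulates l m := by
    obtain ⟨k, hk⟩ := h₂ l
    obtain ⟨n, hn, y, hy, hE⟩ := h.accumulates k m
    exact ⟨n, hn, y, hy, hk q h.mem y (h.subset n hy) hE⟩

theorem GoodFor.transfer {E : K → Ω → Ω → Prop} {E' : L → Ω → Ω → Prop} {X : Set Ω}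
    {𝒟 : Set (Set Ω)} {𝒜 : Set (Ω × (ℕ → Set Ω))} (h : GoodFor E X 𝒟 𝒜)
    (h₁ : ∀ k, ∃ l, ∀ x ∈ X, ∀ y ∈ X, E' l x y → E k x y)
    (h₂ : ∀ l, ∃ k, ∀ x ∈ X, ∀ y ∈ X, E k x y → E' l x y) : GoodFor E' X 𝒟 𝒜 where
  nonempty := h.nonempty
  separated x hx y hy hxy := by
    obtain ⟨k, hk⟩ := h.separated x hx y hy hxy
    obtain ⟨l, hl⟩ := h₁ k
    exact ⟨l, fun hE => hk (hl x hx y hy hE)⟩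
  crowded x hx l := by
    obtain ⟨k, hk⟩ := h₂ l
    obtain ⟨y, hy, hyx, hE⟩ := h.crowded x hx k
    exact ⟨y, hy, hyx, hk x hx y hy hE⟩
  closedDiscrete D hD := by
    refine ⟨(h.closedDiscrete D hD).1, fun x hx => ?_⟩
    obtain ⟨k, hk⟩ := (h.closedDiscrete D hD).2 x hx
    obtain ⟨l, hl⟩ := h₁ k
    exact ⟨l, fun y hy hE => hk y hy (hl x hx y ((h.closedDiscrete D hD).1 hy) hE)⟩
  accumulation a ha := (h.accumulation a ha).transfer h₁ h₂

end Relations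

/-! ### Countably many coordinates: making a discrete sequence closed -/

section Agree

variable {Ω : Type*}

/-- The first `k` coordinates of `x` and `y` under `φ` agree. -/
def AgreeUpTo (φ : Ω → ℕ → Bool) (k : ℕ) (x y : Ω) : Prop := ∀ j < k, φ x j = φ y j

variable {φ : Ω → ℕ → Bool} {X : Set Ω} {𝒟 : Set (Set Ω)} {𝒜 : Set (Ω × (ℕ → Set Ω))}

theorem AgreeUpTo.refl (φ : Ω → ℕ → Bool) (k : ℕ) (x : Ω) : AgreeUpTo φ k x x := fun _ _ => rfl

theorem AgreeUpTo.symm {k : ℕ} {x y : Ω} (h : AgreeUpTo φ k x y) : AgreeUpTo φ k y x :=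
  fun j hj => (h j hj).symm

theorem AgreeUpTo.trans {k : ℕ} {x y z : Ω} (h : AgreeUpTo φ k x y) (h' : AgreeUpTo φ k y z) :
    AgreeUpTo φ k x z := fun j hj => (h j hj).trans (h' j hj)

theorem AgreeUpTo.mono {k l : ℕ} {x y : Ω} (h : AgreeUpTo φ l x y) (hkl : k ≤ l) :
    AgreeUpTo φ k x y := fun j hj => h j (hj.trans_le hkl)

/-- A discrete set can be avoided inside a crowded set. -/
theorem CrowdedFor.exists_notMem {C D : Set Ω} (hC : CrowdedFor (AgreeUpTo φ) C)
    (hD : ∀ x ∈ D, ∃ k, ∀ y ∈ D, AgreeUpTo φ k x y → y = x) {x : Ω} (hx : x ∈ C) (k : ℕ) :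
    ∃ y ∈ C, AgreeUpTo φ k x y ∧ y ∉ D := by
  by_cases hxD : x ∈ D
  · obtain ⟨l, hl⟩ := hD x hxD
    obtain ⟨y, hy, hyx, hE⟩ := hC x hx (max k l)
    exact ⟨y, hy, hE.mono (le_max_left _ _),
      fun hyD => hyx (hl y hyD (hE.mono (le_max_right _ _)))⟩
  · exact ⟨x, hx, AgreeUpTo.refl _ _ _, hxD⟩

theorem CrowdedFor.exists_ne_notMem {C D : Set Ω} (hC : CrowdedFor (AgreeUpTo φ) C)
    (hsep : ∀ x ∈ C, ∀ y ∈ C, x ≠ y → ∃ k, ¬ AgreeUpTo φ k x y)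
    (hD : ∀ x ∈ D, ∃ k, ∀ y ∈ D, AgreeUpTo φ k x y → y = x) {x : Ω} (hx : x ∈ C) (k : ℕ) :
    ∃ y ∈ C, y ≠ x ∧ AgreeUpTo φ k x y ∧ y ∉ D := by
  obtain ⟨y, hy, hyx, hE⟩ := hC x hx k
  obtain ⟨l, hl⟩ := hsep y hy x hx hyx
  obtain ⟨z, hz, hEz, hzD⟩ := hC.exists_notMem hD hy (max k l)
  refine ⟨z, hz, ?_, hE.trans (hEz.mono (le_max_left _ _)), hzD⟩
  rintro rfl
  exact hl (hEz.mono (le_max_right _ _))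

/-- If `s` converges to `x` and avoids `d`, where `d ≠ x`, then it avoids a neighbourhood of `d`. -/
theorem exists_agreeUpTo_avoid (hsep : ∀ x ∈ X, ∀ y ∈ X, x ≠ y → ∃ k, ¬ AgreeUpTo φ k x y)
    {x d : Ω} (hx : x ∈ X) (hd : d ∈ X) (hxd : x ≠ d) {s : ℕ → Ω} (hsX : ∀ j, s j ∈ X)
    (hs : ∀ j, AgreeUpTo φ j x (s j)) (hsd : ∀ j, s j ≠ d) :
    ∃ m, ∀ j, ¬ AgreeUpTo φ m d (s j) := by
  obtain ⟨m₀, hm₀⟩ := hsep x hx d hd hxd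
  choose l hl using fun j => hsep (s j) (hsX j) d hd (hsd j)
  -- Level `m₀` separates `d` from `x`, hence from every `s j` with `j ≥ m₀`; the finitely many
  -- earlier terms are separated one by one.
  refine ⟨max m₀ ((Finset.range m₀).sup l), fun j hj => ?_⟩
  rcases lt_or_ge j m₀ with h | h
  · exact hl j (hj.mono ((Finset.le_sup (Finset.mem_range.2 h)).trans (le_max_right _ _))).symm
  · exact hm₀ (((hs j).mono h).trans (hj.mono (le_max_left _ _)).symm)

/-- A discrete set has an open neighbourhood avoiding tails of countably many sequences that
converge outside of it. -/
theorem exists_open_superset_avoiding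
    (hsep : ∀ x ∈ X, ∀ y ∈ X, x ≠ y → ∃ k, ¬ AgreeUpTo φ k x y)
    {d : ℕ → Ω} (hdX : ∀ n, d n ∈ X)
    (hd : ∀ n, ∃ k, ∀ m, AgreeUpTo φ k (d n) (d m) → d m = d n)
    {x : ℕ → Ω} (hx : ∀ r, x r ∈ X) {s : ℕ → ℕ → Ω} (hsX : ∀ r j, s r j ∈ X)
    (hs : ∀ r j, AgreeUpTo φ j (x r) (s r j)) (hsd : ∀ r j, s r j ∉ range d) :
    ∃ W : Set Ω, (∀ n, d n ∈ W) ∧ (∀ y ∈ W, ∃ k, ∀ z, AgreeUpTo φ k y z → z ∈ W) ∧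
      (∀ y ∈ W, ∃ n k, ∀ m, AgreeUpTo φ k y (d m) → d m = d n) ∧
      ∀ r, x r ∉ W → ∃ j₀, ∀ j ≥ j₀, s r j ∉ W := by
  choose κ hκ using hd
  have key : ∀ n r, ∃ m, x r ≠ d n → ∀ j, ¬ AgreeUpTo φ m (d n) (s r j) := by
    intro n r
    by_cases h : x r = d n
    · exact ⟨0, fun h' => (h' h).elim⟩
    · obtain ⟨m, hm⟩ := exists_agreeUpTo_avoid hsep (hx r) (hdX n) h (hsX r) (hs r)
        (fun j hj => hsd r j ⟨n, hj.symm⟩)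
      exact ⟨m, fun _ => hm⟩
  choose l hl using key
  -- The neighbourhood of `d n` misses every sequence numbered `r < n` with `x r ≠ d n`. If `x r ∉
  -- W`, only the neighbourhoods with `n ≤ r` remain; they are clopen and miss `x r`, so they miss a
  -- tail.
  let M : ℕ → ℕ := fun n => max (κ n) ((Finset.range n).sup (l n))
  refine ⟨{y | ∃ n, AgreeUpTo φ (M n) (d n) y}, fun n => ⟨n, AgreeUpTo.refl _ _ _⟩, ?_, ?_, ?_⟩
  · rintro y ⟨n, hn⟩
    exact ⟨M n, fun z hz => ⟨n, hn.trans hz⟩⟩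
  · rintro y ⟨n, hn⟩
    exact ⟨n, M n, fun m hm => hκ n m ((hn.trans hm).mono (le_max_left _ _))⟩
  · intro r hr
    have hr' : ∀ n, ¬ AgreeUpTo φ (M n) (d n) (x r) := fun n hn => hr ⟨n, hn⟩
    refine ⟨(Finset.range (r + 1)).sup M, ?_⟩
    rintro j hj ⟨n, hn⟩
    rcases lt_or_ge r n with h | h
    · refine hl n r ?_ j (hn.mono ?_)
      · intro he
        exact hr' n (he ▸ AgreeUpTo.refl _ _ _)
      · exact (Finset.le_sup (f := l n) (Finset.mem_range.2 h)).trans (le_max_right _ _)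
    · have : M n ≤ j :=
        (Finset.le_sup (f := M) (Finset.mem_range.2 (Nat.lt_succ_of_le h))).trans hj
      exact hr' n (hn.trans ((hs r j).mono this).symm)

/-- Each `a ∈ ℛ` is a request for witnesses in `a.2 j` converging to `a.1`; choosing them off `range
d` gives the sequences to be avoided. -/
theorem exists_open_superset_avoiding_sets
    (hsep : ∀ x ∈ X, ∀ y ∈ X, x ≠ y → ∃ k, ¬ AgreeUpTo φ k x y)
    {d : ℕ → Ω} (hdX : ∀ n, d n ∈ X)
    (hd : ∀ n, ∃ k, ∀ m, AgreeUpTo φ k (d n) (d m) → d m = d n)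
    {ℛ : Set (Ω × (ℕ → Set Ω))} (hc : ℛ.Countable)
    (hℛ : ∀ a ∈ ℛ, a.1 ∈ X ∧ ∀ j, ∃ y ∈ X, y ∈ a.2 j ∧ AgreeUpTo φ j a.1 y ∧ y ∉ range d) :
    ∃ W : Set Ω, (∀ n, d n ∈ W) ∧ (∀ y ∈ W, ∃ k, ∀ z, AgreeUpTo φ k y z → z ∈ W) ∧
      (∀ y ∈ W, ∃ n k, ∀ m, AgreeUpTo φ k y (d m) → d m = d n) ∧
      ∀ a ∈ ℛ, a.1 ∉ W → ∃ j₀, ∀ j ≥ j₀, ∃ y ∈ a.2 j, AgreeUpTo φ j a.1 y ∧ y ∉ W := by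
  rcases ℛ.eq_empty_or_nonempty with rfl | hne
  · choose κ hκ using hd
    refine ⟨{y | ∃ n, AgreeUpTo φ (κ n) (d n) y}, fun n => ⟨n, AgreeUpTo.refl _ _ _⟩, ?_, ?_,
      by simp⟩
    · rintro y ⟨n, hn⟩
      exact ⟨κ n, fun z hz => ⟨n, hn.trans hz⟩⟩
    · rintro y ⟨n, hn⟩
      exact ⟨n, κ n, fun m hm => hκ n m (hn.trans hm)⟩
  · obtain ⟨e, rfl⟩ := hc.exists_eq_range hne
    choose s hsX hsR hsE hsd using fun r => (hℛ (e r) ⟨r, rfl⟩).2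
    obtain ⟨W, h₁, h₂, h₃, h₄⟩ := exists_open_superset_avoiding hsep hdX hd
      (x := fun r => (e r).1) (fun r => (hℛ (e r) ⟨r, rfl⟩).1) hsX hsE hsd
    refine ⟨W, h₁, h₂, h₃, ?_⟩
    rintro _ ⟨r, rfl⟩ hr
    obtain ⟨j₀, hj₀⟩ := h₄ r hr
    exact ⟨j₀, fun j hj => ⟨s r j, hsR r j, hsE r j, hj₀ j hj⟩⟩

/-- A countable good space can be refined by one clopen set so that a given discrete sequence
becomes closed discrete. -/
theorem GoodFor.exists_refinement (h : GoodFor (AgreeUpTo φ) X 𝒟 𝒜) (hX : X.Countable)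
    (h𝒜 : 𝒜.Countable) {d : ℕ → Ω} (hdX : ∀ n, d n ∈ X)
    (hd : ∀ n, ∃ k, ∀ m, AgreeUpTo φ k (d n) (d m) → d m = d n) :
    ∃ W : Set Ω, GoodFor (fun k x y => AgreeUpTo φ k x y ∧ (x ∈ W ↔ y ∈ W)) X
      (insert (range d) 𝒟) 𝒜 := by
  have hD : ∀ x ∈ range d, ∃ k, ∀ y ∈ range d, AgreeUpTo φ k x y → y = x := by
    rintro _ ⟨n, rfl⟩
    obtain ⟨k, hk⟩ := hd n
    refine ⟨k, ?_⟩
    rintro _ ⟨m, rfl⟩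
    exact hk m
  have hsub : ∀ a ∈ 𝒜, ∀ n, ∀ x ∈ a.2 n, ∀ y ∈ a.2 n, x ≠ y → ∃ k, ¬ AgreeUpTo φ k x y :=
    fun a ha n x hx y hy => h.separated x ((h.accumulation a ha).subset n hx) y
      ((h.accumulation a ha).subset n hy)
  -- Requests for points outside `W`: `ℛ₁` keeps `X` crowded, `ℛ₂` keeps each `a.2 n` crowded, `ℛ₃`
  -- keeps the accumulation at `a.1`, and `ℛ₄` keeps nowhere density.
  let ℛ₁ : Set (Ω × (ℕ → Set Ω)) := (fun x => (x, fun _ => X \ {x})) '' X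
  let ℛ₂ : Set (Ω × (ℕ → Set Ω)) :=
    ⋃ a ∈ 𝒜, ⋃ n : ℕ, (fun x => (x, fun _ => a.2 n \ {x})) '' a.2 n
  let ℛ₃ : Set (Ω × (ℕ → Set Ω)) := (fun a => (a.1, fun j => {y | ∃ n ≥ j, y ∈ a.2 n})) '' 𝒜
  let ℛ₄ : Set (Ω × (ℕ → Set Ω)) := ⋃ a ∈ 𝒜, ⋃ n : ℕ,
    (fun x => (x, fun _ => {y | y ∈ X ∧ ∃ l, ∀ z ∈ a.2 n, ¬ AgreeUpTo φ l y z})) '' X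
  have hc : (ℛ₁ ∪ ℛ₂ ∪ ℛ₃ ∪ ℛ₄).Countable := by
    refine (((hX.image _).union ?_).union (h𝒜.image _)).union ?_
    · exact h𝒜.biUnion fun a ha => countable_iUnion fun n =>
        (hX.mono ((h.accumulation a ha).subset n)).image _
    · exact h𝒜.biUnion fun a ha => countable_iUnion fun n => hX.image _
  have hℛ : ∀ a ∈ ℛ₁ ∪ ℛ₂ ∪ ℛ₃ ∪ ℛ₄, a.1 ∈ X ∧
      ∀ j, ∃ y ∈ X, y ∈ a.2 j ∧ AgreeUpTo φ j a.1 y ∧ y ∉ range d := by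
    rintro b (((hb | hb) | hb) | hb)
    · obtain ⟨x, hx, rfl⟩ := hb
      refine ⟨hx, fun j => ?_⟩
      obtain ⟨y, hy, hyx, hE, hyd⟩ := h.crowded.exists_ne_notMem h.separated hD hx j
      exact ⟨y, hy, ⟨hy, hyx⟩, hE, hyd⟩
    · simp only [ℛ₂, mem_iUnion] at hb
      obtain ⟨a, ha, n, x, hx, rfl⟩ := hb
      refine ⟨(h.accumulation a ha).subset n hx, fun j => ?_⟩
      obtain ⟨y, hy, hyx, hE, hyd⟩ :=
        ((h.accumulation a ha).crowded n).exists_ne_notMem (hsub a ha n) hD hx j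
      exact ⟨y, (h.accumulation a ha).subset n hy, ⟨hy, hyx⟩, hE, hyd⟩
    · obtain ⟨a, ha, rfl⟩ := hb
      refine ⟨(h.accumulation a ha).mem, fun j => ?_⟩
      obtain ⟨n, hn, y, hy, hE⟩ := (h.accumulation a ha).accumulates j j
      obtain ⟨z, hz, hEz, hzd⟩ := ((h.accumulation a ha).crowded n).exists_notMem hD hy j
      exact ⟨z, (h.accumulation a ha).subset n hz, ⟨n, hn, hz⟩, hE.trans hEz, hzd⟩
    · simp only [ℛ₄, mem_iUnion] at hb
      obtain ⟨a, ha, n, x, hx, rfl⟩ := hb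
      refine ⟨hx, fun j => ?_⟩
      obtain ⟨y, hy, hE, l, hl⟩ := (h.accumulation a ha).nowhereDense n x hx j
      obtain ⟨z, hz, hEz, hzd⟩ := h.crowded.exists_notMem hD hy (max j l)
      refine ⟨z, hz, ⟨hz, l, fun w hw hzw => hl w hw ?_⟩, hE.trans (hEz.mono (le_max_left _ _)),
        hzd⟩
      exact (hEz.mono (le_max_right _ _)).trans hzw
  obtain ⟨W, hdW, hWo, hWd, hW⟩ := exists_open_superset_avoiding_sets h.separated hdX hd hc hℛ
  refine ⟨W, h.nonempty, ?_, ?_, ?_, ?_⟩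
  · intro x hx y hy hxy
    obtain ⟨k, hk⟩ := h.separated x hx y hy hxy
    exact ⟨k, fun hE => hk hE.1⟩
  · intro x hx k
    by_cases hxW : x ∈ W
    · obtain ⟨l, hl⟩ := hWo x hxW
      obtain ⟨y, hy, hyx, hE⟩ := h.crowded x hx (max k l)
      exact ⟨y, hy, hyx, hE.mono (le_max_left _ _),
        iff_of_true hxW (hl y (hE.mono (le_max_right _ _)))⟩
    · obtain ⟨j₀, hj⟩ := hW _ (Or.inl (Or.inl (Or.inl ⟨x, hx, rfl⟩))) hxW
      obtain ⟨y, hy, hE, hyW⟩ := hj (max k j₀) (le_max_right _ _)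
      exact ⟨y, hy.1, hy.2, hE.mono (le_max_left _ _), iff_of_false hxW hyW⟩
  · rintro D (rfl | hD')
    · refine ⟨range_subset_iff.2 hdX, fun x hx => ?_⟩
      by_cases hxW : x ∈ W
      · obtain ⟨n, k, hk⟩ := hWd x hxW
        by_cases hxn : x = d n
        · refine ⟨k, ?_⟩
          rintro _ ⟨m, rfl⟩ hE
          rw [hk m hE.1, hxn]
        · obtain ⟨l, hl⟩ := h.separated x hx (d n) (hdX n) hxn
          refine ⟨max k l, ?_⟩
          rintro _ ⟨m, rfl⟩ hE
          have := hk m (hE.1.mono (le_max_left _ _))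
          exact (hl (this ▸ hE.1.mono (le_max_right _ _))).elim
      -- The new clopen set alone separates a point outside `W` from `range d`.
      · refine ⟨0, ?_⟩
        rintro _ ⟨m, rfl⟩ hE
        exact (hxW (hE.2.2 (hdW m))).elim
    · refine ⟨(h.closedDiscrete D hD').1, fun x hx => ?_⟩
      obtain ⟨k, hk⟩ := (h.closedDiscrete D hD').2 x hx
      exact ⟨k, fun y hy hE => hk y hy hE.1⟩
  · intro a ha
    have hA := h.accumulation a ha
    refine ⟨hA.mem, hA.subset, hA.countable, hA.infinite, ?_, ?_, ?_⟩
    · intro n x hx k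
      by_cases hxW : x ∈ W
      · obtain ⟨l, hl⟩ := hWo x hxW
        obtain ⟨y, hy, hyx, hE⟩ := hA.crowded n x hx (max k l)
        exact ⟨y, hy, hyx, hE.mono (le_max_left _ _),
          iff_of_true hxW (hl y (hE.mono (le_max_right _ _)))⟩
      · obtain ⟨j₀, hj⟩ := hW (x, fun _ => a.2 n \ {x}) (Or.inl (Or.inl (Or.inr (by
          simp only [ℛ₂, mem_iUnion]; exact ⟨a, ha, n, x, hx, rfl⟩)))) hxW
        obtain ⟨y, hy, hE, hyW⟩ := hj (max k j₀) (le_max_right _ _)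
        exact ⟨y, hy.1, hy.2, hE.mono (le_max_left _ _), iff_of_false hxW hyW⟩
    · intro n x hx k
      by_cases hxW : x ∈ W
      · obtain ⟨l, hl⟩ := hWo x hxW
        obtain ⟨y, hy, hE, l', hl'⟩ := hA.nowhereDense n x hx (max k l)
        exact ⟨y, hy, ⟨hE.mono (le_max_left _ _),
          iff_of_true hxW (hl y (hE.mono (le_max_right _ _)))⟩, l', fun z hz hz' => hl' z hz hz'.1⟩
      · obtain ⟨j₀, hj⟩ := hW
          (x, fun _ => {y | y ∈ X ∧ ∃ l, ∀ z ∈ a.2 n, ¬ AgreeUpTo φ l y z}) (Or.inr (by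
          simp only [ℛ₄, mem_iUnion]; exact ⟨a, ha, n, x, hx, rfl⟩)) hxW
        obtain ⟨y, ⟨hy, l, hl⟩, hE, hyW⟩ := hj (max k j₀) (le_max_right _ _)
        exact ⟨y, hy, ⟨hE.mono (le_max_left _ _), iff_of_false hxW hyW⟩, l,
          fun z hz hz' => hl z hz hz'.1⟩
    · intro k m
      by_cases hxW : a.1 ∈ W
      · obtain ⟨l, hl⟩ := hWo _ hxW
        obtain ⟨n, hn, y, hy, hE⟩ := hA.accumulates (max k l) m
        exact ⟨n, hn, y, hy, hE.mono (le_max_left _ _),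
          iff_of_true hxW (hl y (hE.mono (le_max_right _ _)))⟩
      · obtain ⟨j₀, hj⟩ := hW _ (Or.inl (Or.inr ⟨a, ha, rfl⟩)) hxW
        obtain ⟨y, ⟨n, hn, hy⟩, hE, hyW⟩ := hj (max (max k m) j₀) (le_max_right _ _)
        exact ⟨n, ((le_max_right k m).trans (le_max_left _ _)).trans hn, y, hy,
          hE.mono ((le_max_left k m).trans (le_max_left _ _)), iff_of_false hxW hyW⟩

end Agree

/-! ### Crowded nowhere dense sets and new accumulation points -/

section Extension

variable {Ω : Type*} {φ : Ω → ℕ → Bool} {X : Set Ω} {𝒟 : Set (Set Ω)}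
  {𝒜 : Set (Ω × (ℕ → Set Ω))}

theorem CrowdedFor.infinite {C : Set Ω} (hC : CrowdedFor (AgreeUpTo φ) C)
    (hsep : ∀ x ∈ C, ∀ y ∈ C, x ≠ y → ∃ k, ¬ AgreeUpTo φ k x y) {x : Ω} (hx : x ∈ C) (k : ℕ) :
    {y | y ∈ C ∧ AgreeUpTo φ k x y}.Infinite := by
  intro hfin
  have : ∀ y, ∃ l, y ∈ C → x ≠ y → ¬ AgreeUpTo φ l x y := by
    intro y
    by_cases h : y ∈ C ∧ x ≠ y
    · obtain ⟨l, hl⟩ := hsep x hx y h.1 h.2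
      exact ⟨l, fun _ _ => hl⟩
    · exact ⟨0, fun h₁ h₂ => (h ⟨h₁, h₂⟩).elim⟩
  choose l hl using this
  obtain ⟨y, hy, hyx, hE⟩ := hC x hx (max k (hfin.toFinset.sup l))
  have hy' : y ∈ hfin.toFinset := hfin.mem_toFinset.2 ⟨hy, hE.mono (le_max_left _ _)⟩
  exact hl y hy hyx.symm (hE.mono ((Finset.le_sup hy').trans (le_max_right _ _)))

/-- Each point of the finite set gets a close companion, for crowdedness. All new points stay so
close to `C` that the neighbourhood of `z` missing `C` misses them as well, for nowhere density. -/
theorem exists_approximation_step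
    (hsep : ∀ x ∈ X, ∀ y ∈ X, x ≠ y → ∃ k, ¬ AgreeUpTo φ k x y)
    (hX : CrowdedFor (AgreeUpTo φ) X) (C : Finset Ω) (hC : ↑C ⊆ X) (l : ℕ) {a : Ω} (ha : a ∈ X)
    (b : ℕ) :
    ∃ (C' : Finset Ω) (l' : ℕ), ↑C' ⊆ X ∧ C ⊆ C' ∧ l ≤ l' ∧
      (∀ c' ∈ C', ∃ c ∈ C, AgreeUpTo φ l' c c') ∧
      (∀ c ∈ C, ∃ c' ∈ C', c' ≠ c ∧ AgreeUpTo φ l' c c') ∧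
      ∃ z ∈ X, AgreeUpTo φ b a z ∧ ∀ c ∈ C, ¬ AgreeUpTo φ l' z c := by
  classical
  obtain ⟨z, ⟨hz, hEz⟩, hzC⟩ := (hX.infinite hsep ha b).exists_notMem_finset C
  have : ∀ c, ∃ m, c ∈ C → ¬ AgreeUpTo φ m z c := by
    intro c
    by_cases h : c ∈ C
    · obtain ⟨m, hm⟩ := hsep z hz c (hC h) (fun e => hzC (e ▸ h))
      exact ⟨m, fun _ => hm⟩
    · exact ⟨0, fun h' => (h h').elim⟩
  choose m hm using this
  have : ∀ c, ∃ c', c ∈ C → c' ∈ X ∧ c' ≠ c ∧ AgreeUpTo φ (max l (C.sup m)) c c' := by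
    intro c
    by_cases h : c ∈ C
    · obtain ⟨c', h'⟩ := hX c (hC h) (max l (C.sup m))
      exact ⟨c', fun _ => h'⟩
    · exact ⟨c, fun h' => (h h').elim⟩
  choose s hs using this
  refine ⟨C ∪ C.image s, max l (C.sup m), ?_, Finset.subset_union_left, le_max_left _ _, ?_, ?_,
    z, hz, hEz, fun c hc hE =>
      hm c hc (hE.mono ((Finset.le_sup (f := m) hc).trans (le_max_right _ _)))⟩
  · intro c hc
    rcases Finset.mem_union.1 (Finset.mem_coe.1 hc) with h | h
    · exact hC h
    · obtain ⟨c₀, hc₀, rfl⟩ := Finset.mem_image.1 h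
      exact (hs c₀ hc₀).1
  · intro c hc
    rcases Finset.mem_union.1 hc with h | h
    · exact ⟨c, h, AgreeUpTo.refl _ _ _⟩
    · obtain ⟨c₀, hc₀, rfl⟩ := Finset.mem_image.1 h
      exact ⟨c₀, hc₀, (hs c₀ hc₀).2.2⟩
  · intro c hc
    exact ⟨s c, Finset.mem_union_right _ (Finset.mem_image_of_mem _ hc), (hs c hc).2⟩

/-- In a countable crowded space, every point of a basic open set lies in an infinite crowded
nowhere dense subset of it. -/
theorem exists_crowded_nowhereDense
    (hsep : ∀ x ∈ X, ∀ y ∈ X, x ≠ y → ∃ k, ¬ AgreeUpTo φ k x y)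
    (hX : CrowdedFor (AgreeUpTo φ) X) (hXc : X.Countable) {x : Ω} (hx : x ∈ X) (k : ℕ) :
    ∃ C ⊆ X, x ∈ C ∧ (∀ y ∈ C, AgreeUpTo φ k x y) ∧ C.Infinite ∧
      CrowdedFor (AgreeUpTo φ) C ∧ NowhereDenseFor (AgreeUpTo φ) X C := by
  classical
  have : Countable X := hXc.to_subtype
  have : Nonempty X := ⟨⟨x, hx⟩⟩
  obtain ⟨e, he⟩ := exists_surjective_nat (X × ℕ)
  let S := {p : Finset Ω × ℕ // ↑p.1 ⊆ X}
  have step : ∀ (n : ℕ) (p : S), ∃ q : S, p.1.1 ⊆ q.1.1 ∧ max p.1.2 n ≤ q.1.2 ∧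
      (∀ c' ∈ q.1.1, ∃ c ∈ p.1.1, AgreeUpTo φ q.1.2 c c') ∧
      (∀ c ∈ p.1.1, ∃ c' ∈ q.1.1, c' ≠ c ∧ AgreeUpTo φ q.1.2 c c') ∧
      ∃ z ∈ X, AgreeUpTo φ (e n).2 (e n).1 z ∧ ∀ c ∈ p.1.1, ¬ AgreeUpTo φ q.1.2 z c := by
    intro n p
    obtain ⟨C', l', h, h'⟩ := exists_approximation_step hsep hX p.1.1 p.2 (max p.1.2 n)
      (e n).1.2 (e n).2
    exact ⟨⟨(C', l'), h⟩, h'⟩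
  choose next hsub hle hback hnew havoid using step
  let p : ℕ → S := fun n => Nat.rec ⟨({x}, k), by simpa using hx⟩ (fun n q => next n q) n
  have hmono : Monotone fun n => (p n).1.1 := monotone_nat_of_le_succ fun n => hsub n (p n)
  have hlmono : Monotone fun n => (p n).1.2 :=
    monotone_nat_of_le_succ fun n => (le_max_left _ _).trans (hle n (p n))
  have hln : ∀ n, n ≤ (p (n + 1)).1.2 := fun n => (le_max_right _ _).trans (hle n (p n))
  -- Later points stay close to stage `n`, so the neighbourhood found at step `n` misses the whole
  -- union.
  have hall : ∀ n m, n ≤ m → ∀ c' ∈ (p m).1.1, ∃ c ∈ (p n).1.1,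
      AgreeUpTo φ (p (n + 1)).1.2 c c' := by
    intro n m hnm
    induction m, hnm using Nat.le_induction with
    | base => exact fun c hc => ⟨c, hc, AgreeUpTo.refl _ _ _⟩
    | succ m hnm ih =>
      intro c' hc'
      obtain ⟨c, hc, hE⟩ := hback m (p m) c' hc'
      obtain ⟨c₀, hc₀, hE₀⟩ := ih c hc
      refine ⟨c₀, hc₀, hE₀.trans ?_⟩
      exact hE.mono (hlmono (Nat.succ_le_succ hnm))
  have hcr : CrowdedFor (AgreeUpTo φ) {y | ∃ n, y ∈ (p n).1.1} := by
    rintro y ⟨n, hn⟩ j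
    obtain ⟨c', hc', hne, hE⟩ := hnew (max n j) (p (max n j)) y (hmono (le_max_left n j) hn)
    exact ⟨c', ⟨max n j + 1, hc'⟩, hne,
      hE.mono ((le_max_right n j).trans (hln (max n j)))⟩
  have hsubX : {y | ∃ n, y ∈ (p n).1.1} ⊆ X := fun y ⟨n, hn⟩ => (p n).2 hn
  have hxC : x ∈ {y | ∃ n, y ∈ (p n).1.1} := ⟨0, Finset.mem_singleton_self x⟩
  refine ⟨{y | ∃ n, y ∈ (p n).1.1}, hsubX, hxC, ?_, ?_, hcr, ?_⟩
  · rintro y ⟨n, hn⟩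
    obtain ⟨c, hc, hE⟩ := hall 0 n (Nat.zero_le _) y hn
    obtain rfl : c = x := Finset.mem_singleton.1 hc
    exact hE.mono (hlmono (Nat.zero_le 1))
  · exact (hcr.infinite (fun a ha b hb => hsep a (hsubX ha) b (hsubX hb)) hxC 0).mono
      fun y hy => hy.1
  · intro a ha b
    obtain ⟨n, hn⟩ := he (⟨a, ha⟩, b)
    obtain ⟨z, hz, hE, hav⟩ := havoid n (p n)
    rw [hn] at hE
    refine ⟨z, hz, hE, (p (n + 1)).1.2, ?_⟩
    rintro c ⟨m, hm⟩ hEc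
    obtain ⟨c₀, hc₀, hE₀⟩ := hall n (max n m) (le_max_left _ _) c (hmono (le_max_right n m) hm)
    exact hav c₀ hc₀ (hEc.trans hE₀.symm)

/-- Sequential compactness of the Cantor space. -/
theorem exists_cluster_sequence (u : ℕ → ℕ → Bool) :
    ∃ g : ℕ → Bool, ∀ k m, ∃ n ≥ m, ∀ j < k, u n j = g j := by
  obtain ⟨g, ν, hν, hlim⟩ := CompactSpace.tendsto_subseq u
  refine ⟨g, fun k m => ?_⟩
  rw [tendsto_pi_nhds] at hlim
  have h₁ : ∀ j, ∀ᶠ n in Filter.atTop, u (ν n) j = g j := fun j =>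
    (hlim j).eventually (Filter.eventually_of_mem ((isOpen_discrete {g j}).mem_nhds rfl) fun _ h => h)
  have h₂ : ∀ᶠ n in Filter.atTop, ∀ j ∈ Finset.range k, u (ν n) j = g j :=
    (Finset.eventually_all _).2 fun j _ => h₁ j
  obtain ⟨n, hn, hm⟩ := (h₂.and (Filter.eventually_ge_atTop m)).exists
  exact ⟨ν n, hm.trans (hν.id_le n), fun j hj => hn j (Finset.mem_range.2 hj)⟩

/-- A countable crowded space is not closed in the Cantor space. -/
theorem exists_cluster_notMem
    (hsep : ∀ x ∈ X, ∀ y ∈ X, x ≠ y → ∃ k, ¬ AgreeUpTo φ k x y)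
    (hX : CrowdedFor (AgreeUpTo φ) X) (hXc : X.Countable) (hne : X.Nonempty) :
    ∃ z : ℕ → Ω, (∀ n, z n ∈ X) ∧ ∃ g : ℕ → Bool,
      (∀ k m, ∃ n ≥ m, ∀ j < k, φ (z n) j = g j) ∧ ∀ q ∈ X, φ q ≠ g := by
  obtain ⟨e, rfl⟩ := hXc.exists_eq_range hne
  -- Diagonalization: step `n` shrinks to a neighbourhood excluding `e n`, so no point of `X` is a
  -- cluster point.
  have step : ∀ (n : ℕ) (p : range e × ℕ), ∃ q : range e × ℕ, p.2 ≤ q.2 ∧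
      AgreeUpTo φ p.2 p.1 q.1 ∧ ¬ AgreeUpTo φ q.2 q.1 (e n) := by
    intro n p
    have : ∃ y ∈ range e, AgreeUpTo φ p.2 p.1 y ∧ y ≠ e n := by
      by_cases h : (p.1 : Ω) = e n
      · obtain ⟨y, hy, hyx, hE⟩ := hX p.1 p.1.2 p.2
        exact ⟨y, hy, hE, h ▸ hyx⟩
      · exact ⟨p.1, p.1.2, AgreeUpTo.refl _ _ _, h⟩
    obtain ⟨y, hy, hE, hyn⟩ := this
    obtain ⟨l, hl⟩ := hsep y hy (e n) ⟨n, rfl⟩ hyn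
    exact ⟨(⟨y, hy⟩, max p.2 l), le_max_left _ _, hE, fun h => hl (h.mono (le_max_right _ _))⟩
  choose next hle hE hne' using step
  let p : ℕ → range e × ℕ := fun n => Nat.rec (⟨e 0, 0, rfl⟩, 0) (fun n q => next n q) n
  have hlmono : Monotone fun n => (p n).2 := monotone_nat_of_le_succ fun n => hle n (p n)
  have hall : ∀ n m, n ≤ m → AgreeUpTo φ (p n).2 (p n).1 (p m).1 := by
    intro n m hnm
    induction m, hnm using Nat.le_induction with
    | base => exact AgreeUpTo.refl _ _ _
    | succ m hnm ih => exact ih.trans ((hE m (p m)).mono (hlmono hnm))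
  obtain ⟨g, hg⟩ := exists_cluster_sequence fun n => φ (p n).1
  refine ⟨fun n => (p n).1, fun n => (p n).1.2, g, hg, ?_⟩
  rintro _ ⟨n, rfl⟩ hq
  obtain ⟨m, hm, hgm⟩ := hg (p (n + 1)).2 (n + 1)
  refine hne' n (p n) ((hall (n + 1) m hm).trans fun j hj => ?_)
  rw [hq]
  exact hgm j hj

open Classical in
/-- A new point `t` can be added to a countable good space as an accumulation point of a family of
crowded nowhere dense sets that has a cluster point outside of the space. -/
theorem GoodFor.exists_insert_point (h : GoodFor (AgreeUpTo φ) X 𝒟 𝒜) (hX : X.Countable)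
    (h𝒟 : 𝒟.Countable)
    {x : ℕ → Ω} {A : ℕ → Set Ω} (hxA : ∀ n, x n ∈ A n) (hAX : ∀ n, A n ⊆ X)
    (hAi : ∀ n, (A n).Infinite) (hAc : ∀ n, CrowdedFor (AgreeUpTo φ) (A n))
    (hAn : ∀ n, NowhereDenseFor (AgreeUpTo φ) X (A n)) {g : ℕ → Bool}
    (hg : ∀ k m, ∃ n ≥ m, ∀ j < k, φ (x n) j = g j) (hgX : ∀ q ∈ X, φ q ≠ g) {t : Ω}
    (ht : t ∉ X) :
    ∃ G : Set Ω, GoodFor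
      (fun k x y => AgreeUpTo (Function.update φ t g) k x y ∧ (x ∈ G ↔ y ∈ G))
      (insert t X) 𝒟 (insert (t, A) 𝒜) := by
  -- Inserting `∅` allows an enumeration even if `𝒟` is empty.
  obtain ⟨e, he⟩ := (h𝒟.insert ∅).exists_eq_range (insert_nonempty _ _)
  have heX : ∀ i, ClosedDiscreteFor (AgreeUpTo φ) X (e i) := by
    intro i
    rcases (he ▸ mem_range_self i : e i ∈ insert ∅ 𝒟) with h' | h'
    · rw [h']
      exact fun x _ => ⟨0, fun y hy => hy.elim⟩
    · exact (h.closedDiscrete _ h').2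
  have hUn : ∀ k, ∀ q ∈ X, ∃ l, ∀ i < k, ∀ y ∈ e i, AgreeUpTo φ l q y → y = q := by
    intro k q hq
    choose l hl using fun i => heX i q hq
    exact ⟨(Finset.range k).sup l, fun i hi y hy hE =>
      hl i y hy (hE.mono (Finset.le_sup (Finset.mem_range.2 hi)))⟩
  have hsubX : ∀ i, e i ⊆ X := by
    intro i
    rcases (he ▸ mem_range_self i : e i ∈ insert ∅ 𝒟) with h' | h'
    · simp [h']
    · exact (h.closedDiscrete _ h').1
  -- The point `y` lies in a late `A n`, agrees with `g` below `k`, and has a neighbourhood of level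
  -- `m` that excludes `g` and misses the first `k` closed discrete sets. Crowdedness of `A n` lets
  -- `y` avoid those sets.
  have hchoice : ∀ k, ∃ n y m, k ≤ n ∧ y ∈ A n ∧ (∀ j < k, φ y j = g j) ∧ k ≤ m ∧
      (∀ i < k, ∀ z ∈ e i, ¬ AgreeUpTo φ m y z) ∧ ∃ j < m, φ y j ≠ g j := by
    intro k
    obtain ⟨n, hn, hxg⟩ := hg k k
    obtain ⟨y, hy, hE, hyD⟩ := (hAc n).exists_notMem (D := {z | ∃ i < k, z ∈ e i})
      (by
        rintro z ⟨i, hi, hz⟩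
        obtain ⟨l, hl⟩ := hUn k z (hsubX i hz)
        exact ⟨l, fun w ⟨i', hi', hw⟩ hE => hl i' hi' w hw hE⟩) (hxA n) k
    obtain ⟨l, hl⟩ := hUn k y (hAX n hy)
    obtain ⟨j, hj⟩ := Function.ne_iff.1 (hgX y (hAX n hy))
    refine ⟨n, y, max (max k l) (j + 1), hn, hy, fun i hi => (hE i hi).symm.trans (hxg i hi),
      (le_max_left _ _).trans (le_max_left _ _), ?_, j, by
        exact (Nat.lt_succ_self j).trans_le (le_max_right _ _), hj⟩
    intro i hi z hz hEz
    have := hl i hi z hz (hEz.mono ((le_max_right _ _).trans (le_max_left _ _)))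
    exact hyD ⟨i, hi, this ▸ hz⟩
  choose ν y m hν hyA hyg hkm hme hmg using hchoice
  have hyX : ∀ k, y k ∈ X := fun k => hAX _ (hyA k)
  set V : ℕ → Set Ω := fun k => {z | z ∈ X ∧ AgreeUpTo φ (m k) (y k) z} with hV
  have hyV : ∀ k, y k ∈ V k := fun k => ⟨hyX k, AgreeUpTo.refl _ _ _⟩
  have hVg : ∀ k, ∀ z ∈ V k, ∀ j < k, φ z j = g j := fun k z hz j hj =>
    (hz.2 j (hj.trans_le (hkm k))).symm.trans (hyg k j hj)
  set G : Set Ω := insert t {z | ∃ k, z ∈ V k} with hG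
  have htG : t ∈ G := mem_insert _ _
  have hne : ∀ q ∈ X, q ≠ t := fun q hq e => ht (e ▸ hq)
  have hGV : ∀ q ∈ X, q ∈ G ↔ ∃ k, q ∈ V k := fun q hq =>
    ⟨fun hq' => hq'.resolve_left (hne q hq), fun hq' => Or.inr hq'⟩
  set ψ := Function.update φ t g with hψ
  have hψX : ∀ q ∈ X, ψ q = φ q := fun q hq => Function.update_of_ne (hne q hq) _ _
  have hψt : ψ t = g := Function.update_self _ _ _
  have hag : ∀ k, ∀ q ∈ X, ∀ z ∈ X, AgreeUpTo ψ k q z ↔ AgreeUpTo φ k q z := by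
    intro k q hq z hz
    simp only [AgreeUpTo, hψX q hq, hψX z hz]
  -- `G` is clopen on the old points: `V k` agrees with `g` below `k`, so near a point differing
  -- from `g` at `j` only the `V k` with `k ≤ j` matter.
  have hloc : ∀ q ∈ X, ∃ l, ∀ z ∈ X, AgreeUpTo φ l q z → (q ∈ G ↔ z ∈ G) := by
    intro q hq
    obtain ⟨j, hj⟩ := Function.ne_iff.1 (hgX q hq)
    refine ⟨max (j + 1) ((Finset.range (j + 1)).sup m), fun z hz hE => ?_⟩
    rw [hGV q hq, hGV z hz]
    have hqz : φ q j = φ z j := hE j ((Nat.lt_succ_self j).trans_le (le_max_left _ _))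
    have hk : ∀ k, k ≤ j → AgreeUpTo φ (m k) q z := fun k hk =>
      hE.mono ((Finset.le_sup (Finset.mem_range.2 (Nat.lt_succ_of_le hk))).trans
        (le_max_right _ _))
    constructor
    · rintro ⟨k, hk'⟩
      have : k ≤ j := not_lt.1 fun hlt => hj (hVg k q hk' j hlt)
      exact ⟨k, hz, hk'.2.trans (hk k this)⟩
    · rintro ⟨k, hk'⟩
      have : k ≤ j := not_lt.1 fun hlt => hj (hqz.trans (hVg k z hk' j hlt))
      exact ⟨k, hq, hk'.2.trans (hk k this).symm⟩
  set E' : ℕ → Ω → Ω → Prop := fun k x y => AgreeUpTo ψ k x y ∧ (x ∈ G ↔ y ∈ G) with hE'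
  have hto : ∀ q ∈ X, ∀ k, ∃ l, ∀ z ∈ X, AgreeUpTo φ l q z → E' k q z := by
    intro q hq k
    obtain ⟨l, hl⟩ := hloc q hq
    exact ⟨max k l, fun z hz hE => ⟨(hag k q hq z hz).2 (hE.mono (le_max_left _ _)),
      hl z hz (hE.mono (le_max_right _ _))⟩⟩
  have hof : ∀ q ∈ X, ∀ k, ∀ z ∈ X, E' k q z → AgreeUpTo φ k q z := fun q hq k z hz hE =>
    (hag k q hq z hz).1 hE.1
  have htV : ∀ k, ∀ z ∈ V k, E' k t z := by
    intro k z hz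
    refine ⟨fun j hj => ?_, iff_of_true htG (Or.inr ⟨k, hz⟩)⟩
    rw [hψt, hψX z hz.1, hVg k z hz j hj]
  have hmonoE : ∀ {k l a b}, k ≤ l → E' l a b → E' k a b := fun hkl hE => ⟨hE.1.mono hkl, hE.2⟩
  have hcr : ∀ C ⊆ X, CrowdedFor (AgreeUpTo φ) C → CrowdedFor E' C := by
    intro C hCX hC q hq k
    obtain ⟨l, hl⟩ := hto q (hCX hq) k
    obtain ⟨z, hz, hzq, hE⟩ := hC q hq l
    exact ⟨z, hz, hzq, hl z (hCX hz) hE⟩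
  have hnw : ∀ C ⊆ X, NowhereDenseFor (AgreeUpTo φ) X C → NowhereDenseFor E' (insert t X) C := by
    intro C hCX hC
    have key : ∀ q ∈ X, ∀ k, ∃ y ∈ insert t X, E' k q y ∧ ∃ l, ∀ z ∈ C, ¬ E' l y z := by
      intro q hq k
      obtain ⟨l, hl⟩ := hto q hq k
      obtain ⟨z, hz, hE, l', hl'⟩ := hC q hq l
      exact ⟨z, Or.inr hz, hl z hz hE, l', fun w hw hE' => hl' w hw (hof z hz l' w (hCX hw) hE')⟩
    rintro q (rfl | hq) k
    · obtain ⟨z, hz, hE, hz'⟩ := key (y k) (hyX k) k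
      have h₁ := htV k (y k) (hyV k)
      exact ⟨z, hz, ⟨h₁.1.trans hE.1, h₁.2.trans hE.2⟩, hz'⟩
    · exact key q hq k
  have htq : ∀ q ∈ X, ∃ k, ¬ E' k t q ∧ ¬ E' k q t := by
    intro q hq
    obtain ⟨j, hj⟩ := Function.ne_iff.1 (hgX q hq)
    refine ⟨j + 1, fun hE => hj ?_, fun hE => hj ?_⟩
    · have := hE.1 j (Nat.lt_succ_self j)
      rw [hψt, hψX q hq] at this
      exact this.symm
    · have := hE.1 j (Nat.lt_succ_self j)
      rwa [hψt, hψX q hq] at this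
  refine ⟨G, insert_nonempty _ _, ?_, ?_, ?_, ?_⟩
  · rintro a (rfl | ha) b (rfl | hb) hab
    · exact (hab rfl).elim
    · exact (htq b hb).imp fun k hk => hk.1
    · exact (htq a ha).imp fun k hk => hk.2
    · obtain ⟨k, hk⟩ := h.separated a ha b hb hab
      exact ⟨k, fun hE => hk (hof a ha k b hb hE)⟩
  · rintro q (rfl | hq) k
    · exact ⟨y k, Or.inr (hyX k), hne _ (hyX k), htV k _ (hyV k)⟩
    · obtain ⟨z, hz, hzq, hE⟩ := hcr X subset_rfl h.crowded q hq k
      exact ⟨z, Or.inr hz, hzq, hE⟩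
  · intro D hD
    have hDX := (h.closedDiscrete D hD).1
    refine ⟨hDX.trans (subset_insert _ _), ?_⟩
    rintro q (rfl | hq)
    · obtain ⟨i, hi⟩ : D ∈ range e := he ▸ mem_insert_of_mem _ hD
      -- This level excludes `V k` for `k ≤ i` by `hmg`, and `V k` for `k > i` misses `D = e i` by
      -- `hme`.
      refine ⟨(Finset.range (i + 1)).sup m, fun z hz hE => ?_⟩
      obtain ⟨k, hk⟩ := (hGV z (hDX hz)).1 (hE.2.1 htG)
      rcases lt_or_ge i k with hik | hki
      · exact (hme k i hik z (hi ▸ hz) hk.2).elim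
      · obtain ⟨j, hj, hjg⟩ := hmg k
        refine (hjg ?_).elim
        have h₁ := hE.1 j (hj.trans_le
          (Finset.le_sup (f := m) (Finset.mem_range.2 (Nat.lt_succ_of_le hki))))
        rw [hψt, hψX z (hDX hz)] at h₁
        rw [h₁, hk.2 j hj]
    · obtain ⟨k, hk⟩ := (h.closedDiscrete D hD).2 q hq
      exact ⟨k, fun z hz hE => hk z hz (hof q hq k z (hDX hz) hE)⟩
  · rintro a (rfl | ha)
    · refine ⟨mem_insert _ _, fun n => (hAX n).trans (subset_insert _ _),
        fun n => hX.mono (hAX n), hAi,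
        fun n => hcr _ (hAX n) (hAc n), fun n => hnw _ (hAX n) (hAn n), fun k l => ?_⟩
      exact ⟨ν (max k l), (le_max_right k l).trans (hν _), y (max k l), hyA _,
        hmonoE (le_max_left k l) (htV _ _ (hyV _))⟩
    · have hA := h.accumulation a ha
      refine ⟨Or.inr hA.mem, fun n => (hA.subset n).trans (subset_insert _ _), hA.countable, hA.infinite,
        fun n => hcr _ (hA.subset n) (hA.crowded n),
        fun n => hnw _ (hA.subset n) (hA.nowhereDense n), fun k l => ?_⟩
      obtain ⟨k', hk'⟩ := hto a.1 hA.mem k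
      obtain ⟨n, hn, z, hz, hE⟩ := hA.accumulates k' l
      exact ⟨n, hn, z, hz, hk' z (hA.subset n hz) hE⟩

end Extension

/-! ### Meeting `ℵ₁` many dense sets in a countably closed order -/

section Generic

variable {P : Type*} [Preorder P]

/-- In a countably closed preorder, countably many dense upper sets have a common element above
any given one. -/
theorem exists_ge_forall_mem (hP : ∀ s : ℕ → P, Monotone s → ∃ b, ∀ n, s n ≤ b)
    {D : ℕ → Set P} (hD : ∀ n, IsUpperSet (D n)) (hd : ∀ n p, ∃ q ≥ p, q ∈ D n) (p : P) :
    ∃ q ≥ p, ∀ n, q ∈ D n := by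
  choose next hle hmem using hd
  let s : ℕ → P := fun n => Nat.rec p (fun n q => next n q) n
  obtain ⟨b, hb⟩ := hP s (monotone_nat_of_le_succ fun n => hle n (s n))
  exact ⟨b, hb 0, fun n => hD n (hb (n + 1)) (hmem n (s n))⟩

/-- In a countably closed preorder, at most `ℵ₁` many dense sets are met by a directed family. -/
theorem exists_directed_forall_mem [Nonempty P]
    (hP : ∀ s : ℕ → P, Monotone s → ∃ b, ∀ n, s n ≤ b) {J : Type*} (hJ : #J ≤ aleph 1)
    {D : J → Set P} (hd : ∀ j p, ∃ q ≥ p, q ∈ D j) :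
    ∃ G : J → P, Directed (· ≤ ·) G ∧ ∀ j, G j ∈ D j := by
  classical
  -- In a well-order of minimal type on `J` initial segments are countable, so the recursion finds
  -- an upper bound at every stage.
  obtain ⟨_, _, hr⟩ := Cardinal.exists_ord_eq_type_lt J
  have hcount : ∀ j : J, (Iio j).Countable := fun j => by
    rw [← Cardinal.le_aleph0_iff_set_countable, ← Cardinal.lt_aleph_one_iff]
    exact (Cardinal.mk_Iio_lt j hr).trans_le hJ
  let F : ∀ j, (∀ i, i < j → P) → P := fun j g =>
    if h : ∃ q ∈ D j, ∀ i (hi : i < j), g i hi ≤ q then h.choose else Classical.arbitrary P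
  let G : J → P := wellFounded_lt.fix F
  have hG : ∀ j, (∃ q ∈ D j, ∀ i, i < j → G i ≤ q) → G j ∈ D j ∧ ∀ i, i < j → G i ≤ G j := by
    intro j h
    have h' : G j = h.choose := by
      change wellFounded_lt.fix F j = _
      rw [WellFounded.fix_eq]
      exact dif_pos h
    rw [h']
    exact h.choose_spec
  have main : ∀ j, G j ∈ D j ∧ ∀ i, i < j → G i ≤ G j := by
    intro j
    induction j using WellFoundedLT.induction with
    | _ j ih =>
      refine hG j ?_
      rcases isEmpty_or_nonempty {i // i < j} with he | he
      · obtain ⟨q, -, hq⟩ := hd j (Classical.arbitrary P)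
        exact ⟨q, hq, fun i hi => (he.false ⟨i, hi⟩).elim⟩
      · have : Countable {i // i < j} := (hcount j).to_subtype
        let := Encodable.ofCountable {i // i < j}
        let : Inhabited {i // i < j} := ⟨he.some⟩
        have hdir : Directed (· ≤ ·) fun i : {i // i < j} => G i := by
          intro a b
          rcases lt_trichotomy a.1 b.1 with h | h | h
          · exact ⟨b, (ih b.1 b.2).2 _ h, le_rfl⟩
          · exact ⟨b, (congrArg G h).le, le_rfl⟩
          · exact ⟨a, le_rfl, (ih a.1 a.2).2 _ h⟩
        obtain ⟨b, hb⟩ := hP _ hdir.sequence_mono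
        obtain ⟨q, hbq, hq⟩ := hd j b
        exact ⟨q, hq, fun i hi => (hdir.le_sequence ⟨i, hi⟩).trans ((hb _).trans hbq)⟩
  refine ⟨G, fun a b => ?_, fun j => (main j).1⟩
  rcases lt_trichotomy a b with h | h | h
  · exact ⟨b, (main b).2 _ h, le_rfl⟩
  · exact ⟨b, (congrArg G h).le, le_rfl⟩
  · exact ⟨a, le_rfl, (main a).2 _ h⟩

end Generic

/-! ### Countable approximations and their extensions -/

section Partial

/-- `x` and `y` agree under `f` on the coordinates of `F` that belong to `I`. -/
def AgreeOn {Ω : Type*} (f : Ω → Ω → Bool) (I : Set Ω) (F : Finset Ω) (x y : Ω) : Prop :=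
  ∀ i ∈ F, i ∈ I → f x i = f y i

/-- A set of points `X`, topologized by the coordinates `I` of the map `f`, together with families
of closed discrete sets and of accumulating sequences of crowded nowhere dense sets. -/
structure PartialSpace (Ω : Type*) where
  X : Set Ω
  I : Set Ω
  f : Ω → Ω → Bool
  𝒟 : Set (Set Ω)
  𝒜 : Set (Ω × (ℕ → Set Ω))
  good : GoodFor (AgreeOn f I) X 𝒟 𝒜

namespace PartialSpace

variable {Ω : Type*}

instance : Preorder (PartialSpace Ω) where
  le p q := p.X ⊆ q.X ∧ p.I ⊆ q.I ∧ p.𝒟 ⊆ q.𝒟 ∧ p.𝒜 ⊆ q.𝒜 ∧ ∀ x ∈ p.X, ∀ i ∈ p.I, p.f x i = q.f x i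
  le_refl p := ⟨subset_rfl, subset_rfl, subset_rfl, subset_rfl, fun _ _ _ _ => rfl⟩
  le_trans p q r h h' := ⟨h.1.trans h'.1, h.2.1.trans h'.2.1, h.2.2.1.trans h'.2.2.1,
    h.2.2.2.1.trans h'.2.2.2.1, fun x hx i hi =>
      (h.2.2.2.2 x hx i hi).trans (h'.2.2.2.2 x (h.1 hx) i (h.2.1 hi))⟩

theorem agreeOn_of_le {p q : PartialSpace Ω} (h : p ≤ q) {F : Finset Ω} {x y : Ω} (hx : x ∈ p.X)
    (hy : y ∈ p.X) (hE : AgreeOn q.f q.I F x y) : AgreeOn p.f p.I F x y := fun i hiF hi => by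
  rw [h.2.2.2.2 x hx i hi, h.2.2.2.2 y hy i hi]
  exact hE i hiF (h.2.1 hi)

theorem agreeOn_iff_of_le {p q : PartialSpace Ω} (h : p ≤ q) {F : Finset Ω}
    (hF : ∀ i ∈ F, i ∈ q.I → i ∈ p.I) {x y : Ω} (hx : x ∈ p.X)
    (hy : y ∈ p.X) : AgreeOn q.f q.I F x y ↔ AgreeOn p.f p.I F x y :=
  ⟨agreeOn_of_le h hx hy, fun hE i hiF hi => by
    rw [← h.2.2.2.2 x hx i (hF i hiF hi), ← h.2.2.2.2 y hy i (hF i hiF hi)]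
    exact hE i hiF (hF i hiF hi)⟩

/-- All the data of a partial space are countable. -/
structure IsCountable (p : PartialSpace Ω) : Prop where
  X : p.X.Countable
  I : p.I.Countable
  𝒟 : p.𝒟.Countable
  𝒜 : p.𝒜.Countable

-- Points and finitely many coordinates appear together at a single stage, where a basic
-- neighbourhood is already determined; each required property can be checked there.
open Classical in
theorem exists_directed_union {ι : Type*} [Nonempty ι] {p : ι → PartialSpace Ω}
    (hp : Directed (· ≤ ·) p) :
    ∃ q : PartialSpace Ω, (∀ i, p i ≤ q) ∧ q.X = ⋃ i, (p i).X ∧ q.I = ⋃ i, (p i).I ∧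
      q.𝒟 = ⋃ i, (p i).𝒟 ∧ q.𝒜 = ⋃ i, (p i).𝒜 := by
  let f : Ω → Ω → Bool := fun x i =>
    if h : ∃ j, x ∈ (p j).X ∧ i ∈ (p j).I then (p h.choose).f x i else false
  have hf : ∀ j, ∀ x ∈ (p j).X, ∀ i ∈ (p j).I, f x i = (p j).f x i := by
    intro j x hx i hi
    have h : ∃ j, x ∈ (p j).X ∧ i ∈ (p j).I := ⟨j, hx, hi⟩
    have h₁ : f x i = (p h.choose).f x i := dif_pos h
    obtain ⟨k, hk, hk'⟩ := hp h.choose j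
    rw [h₁, hk.2.2.2.2 x h.choose_spec.1 i h.choose_spec.2, hk'.2.2.2.2 x hx i hi]
  have hto : ∀ j F x y, x ∈ (p j).X → y ∈ (p j).X → AgreeOn f (⋃ i, (p i).I) F x y →
      AgreeOn (p j).f (p j).I F x y := by
    intro j F x y hx hy hE i hiF hi
    rw [← hf j x hx i hi, ← hf j y hy i hi]
    exact hE i hiF (mem_iUnion.2 ⟨j, hi⟩)
  have hof : ∀ j (F : Finset Ω), ∃ k, p j ≤ p k ∧ ∀ x y, x ∈ (p k).X → y ∈ (p k).X →
      AgreeOn (p k).f (p k).I F x y → AgreeOn f (⋃ i, (p i).I) F x y := by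
    intro j F
    have : ∀ i, ∃ k, i ∈ ⋃ i, (p i).I → i ∈ (p k).I := by
      intro i
      by_cases h : i ∈ ⋃ i, (p i).I
      · exact (mem_iUnion.1 h).imp fun k hk _ => hk
      · exact ⟨j, fun h' => (h h').elim⟩
    choose l hl using this
    obtain ⟨k, hk⟩ := hp.finset_le (insert j (F.image l))
    refine ⟨k, hk j (Finset.mem_insert_self _ _), fun x y hx hy hE i hiF hi => ?_⟩
    have hik : i ∈ (p k).I :=
      (hk (l i) (Finset.mem_insert_of_mem (Finset.mem_image_of_mem _ hiF))).2.1 (hl i hi)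
    rw [hf k x hx i hik, hf k y hy i hik]
    exact hE i hiF hik
  have hX : ∀ j, (p j).X ⊆ ⋃ i, (p i).X := fun j => subset_iUnion (fun i => (p i).X) j
  refine ⟨⟨⋃ i, (p i).X, ⋃ i, (p i).I, f, ⋃ i, (p i).𝒟, ⋃ i, (p i).𝒜, ?_, ?_, ?_, ?_, ?_⟩,
    fun i => ⟨hX i, subset_iUnion (fun i => (p i).I) i, subset_iUnion (fun i => (p i).𝒟) i,
      subset_iUnion (fun i => (p i).𝒜) i, fun x hx j hj => (hf i x hx j hj).symm⟩,
    rfl, rfl, rfl, rfl⟩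
  · obtain ⟨i⟩ := ‹Nonempty ι›
    exact (p i).good.nonempty.mono (hX i)
  · intro x hx y hy hxy
    obtain ⟨i, hi⟩ := mem_iUnion.1 hx
    obtain ⟨j, hj⟩ := mem_iUnion.1 hy
    obtain ⟨k, hik, hjk⟩ := hp i j
    obtain ⟨F, hF⟩ := (p k).good.separated x (hik.1 hi) y (hjk.1 hj) hxy
    exact ⟨F, fun hE => hF (hto k F x y (hik.1 hi) (hjk.1 hj) hE)⟩
  · intro x hx F
    obtain ⟨i, hi⟩ := mem_iUnion.1 hx
    obtain ⟨k, hik, hk⟩ := hof i F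
    obtain ⟨y, hy, hyx, hE⟩ := (p k).good.crowded x (hik.1 hi) F
    exact ⟨y, hX k hy, hyx, hk x y (hik.1 hi) hy hE⟩
  · intro D hD
    obtain ⟨j, hj⟩ := mem_iUnion.1 hD
    refine ⟨((p j).good.closedDiscrete D hj).1.trans (hX j), fun x hx => ?_⟩
    obtain ⟨i, hi⟩ := mem_iUnion.1 hx
    obtain ⟨k, hik, hjk⟩ := hp i j
    obtain ⟨F, hF⟩ := ((p k).good.closedDiscrete D (hjk.2.2.1 hj)).2 x (hik.1 hi)
    exact ⟨F, fun y hy hE => hF y hy (hto k F x y (hik.1 hi)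
      (((p k).good.closedDiscrete D (hjk.2.2.1 hj)).1 hy) hE)⟩
  · intro a ha
    obtain ⟨j, hj⟩ := mem_iUnion.1 ha
    have hA := (p j).good.accumulation a hj
    refine ⟨hX j hA.mem, fun n => (hA.subset n).trans (hX j), hA.countable, hA.infinite, ?_, ?_, ?_⟩
    · intro n x hx F
      obtain ⟨k, hjk, hk⟩ := hof j F
      obtain ⟨y, hy, hyx, hE⟩ :=
        ((p k).good.accumulation a (hjk.2.2.2.1 hj)).crowded n x hx F
      exact ⟨y, hy, hyx, hk x y (hjk.1 (hA.subset n hx)) (hjk.1 (hA.subset n hy)) hE⟩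
    · intro n x hx F
      obtain ⟨i, hi⟩ := mem_iUnion.1 hx
      obtain ⟨l, hil, hjl⟩ := hp i j
      obtain ⟨k, hlk, hk⟩ := hof l F
      have hjk := hjl.trans hlk
      have hik := hil.trans hlk
      obtain ⟨y, hy, hE, F', hF'⟩ :=
        ((p k).good.accumulation a (hjk.2.2.2.1 hj)).nowhereDense n x (hik.1 hi) F
      exact ⟨y, hX k hy, hk x y (hik.1 hi) hy hE, F', fun z hz hE' =>
        hF' z hz (hto k F' y z hy (hjk.1 (hA.subset n hz)) hE')⟩
    · intro F m
      obtain ⟨k, hjk, hk⟩ := hof j F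
      obtain ⟨n, hn, y, hy, hE⟩ :=
        ((p k).good.accumulation a (hjk.2.2.2.1 hj)).accumulates F m
      exact ⟨n, hn, y, hy, hk _ y (hjk.1 hA.mem) (hjk.1 (hA.subset n hy)) hE⟩

theorem exists_countable_upper_bound (s : ℕ → {p : PartialSpace Ω // p.IsCountable})
    (hs : Monotone s) : ∃ b, ∀ n, s n ≤ b := by
  obtain ⟨q, hq, hX, hI, h𝒟, h𝒜⟩ := exists_directed_union (p := fun n => (s n).1)
    (Monotone.directed_le fun _ _ h => hs h)
  refine ⟨⟨q, ?_, ?_, ?_, ?_⟩, hq⟩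
  · rw [hX]; exact countable_iUnion fun n => (s n).2.X
  · rw [hI]; exact countable_iUnion fun n => (s n).2.I
  · rw [h𝒟]; exact countable_iUnion fun n => (s n).2.𝒟
  · rw [h𝒜]; exact countable_iUnion fun n => (s n).2.𝒜

-- A copy of the rationals: finite subsets of `ℕ`, with membership as coordinates, form a countable
-- dense subset of the Cantor space.
open Classical in
theorem exists_isCountable [Infinite Ω] : ∃ p : PartialSpace Ω, p.IsCountable := by
  have hem : Nonempty (Finset ℕ ↪ Ω) := by
    rw [← Cardinal.lift_mk_le']
    simp
  obtain ⟨u⟩ := hem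
  let v : ℕ ↪ Ω := Infinite.natEmbedding Ω
  let f : Ω → Ω → Bool := fun x i => decide (∃ s n, u s = x ∧ v n = i ∧ n ∈ s)
  have hf : ∀ s n, f (u s) (v n) = decide (n ∈ s) := by
    intro s n
    simp only [f, decide_eq_decide]
    constructor
    · rintro ⟨s', n', hs, hn, h⟩
      rwa [← u.injective hs, ← v.injective hn]
    · exact fun h => ⟨s, n, rfl, rfl, h⟩
  refine ⟨⟨range u, range v, f, ∅, ∅, range_nonempty _, ?_, ?_, by simp, by simp⟩,
    countable_range _, countable_range _, countable_empty, countable_empty⟩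
  · rintro _ ⟨s, rfl⟩ _ ⟨s', rfl⟩ hne
    have : s ≠ s' := fun h => hne (congrArg u h)
    obtain ⟨n, hn⟩ : ∃ n, ¬ (n ∈ s ↔ n ∈ s') := by
      by_contra! h
      exact this (Finset.ext h)
    refine ⟨{v n}, fun hE => hn ?_⟩
    have := hE (v n) (Finset.mem_singleton_self _) ⟨n, rfl⟩
    rwa [hf, hf, decide_eq_decide] at this
  · rintro _ ⟨s, rfl⟩ F
    obtain ⟨n, hn⟩ := Infinite.exists_notMem_finset (s ∪ F.preimage v v.injective.injOn)
    rw [Finset.mem_union, not_or, Finset.mem_preimage] at hn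
    refine ⟨u (insert n s), ⟨_, rfl⟩, fun h => hn.1 ?_, ?_⟩
    · rw [← u.injective h]
      exact Finset.mem_insert_self _ _
    · rintro _ hiF ⟨m, rfl⟩
      rw [hf, hf, decide_eq_decide, Finset.mem_insert]
      have : m ≠ n := fun h => hn.2 (h ▸ hiF)
      simp [this]

theorem nonempty_I (p : PartialSpace Ω) : p.I.Nonempty := by
  obtain ⟨x, hx⟩ := p.good.nonempty
  obtain ⟨y, hy, hyx, -⟩ := p.good.crowded x hx ∅
  obtain ⟨F, hF⟩ := p.good.separated y hy x hx hyx
  by_contra h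
  rw [not_nonempty_iff_eq_empty] at h
  exact hF fun i _ hi => by simp [h] at hi

section Coordinates

variable {e : ℕ → Ω} {I : Set Ω} {f : Ω → Ω → Bool}

theorem exists_agreeOn_of_agreeUpTo (he : range e = I) (F : Finset Ω) :
    ∃ k, ∀ x y, AgreeUpTo (fun x j => f x (e j)) k x y → AgreeOn f I F x y := by
  have : ∀ i, ∃ j, i ∈ I → e j = i := by
    intro i
    by_cases h : i ∈ I
    · obtain ⟨j, rfl⟩ := he ▸ h
      exact ⟨j, fun _ => rfl⟩
    · exact ⟨0, fun h' => (h h').elim⟩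
  choose l hl using this
  refine ⟨F.sup fun i => l i + 1, fun x y hE i hiF hi => ?_⟩
  have := hE (l i) (Nat.lt_of_succ_le (Finset.le_sup (f := fun i => l i + 1) hiF))
  simpa only [hl i hi] using this

theorem exists_agreeUpTo_of_agreeOn (he : range e = I) (k : ℕ) :
    ∃ F : Finset Ω, ∀ x y, AgreeOn f I F x y → AgreeUpTo (fun x j => f x (e j)) k x y := by
  classical
  exact ⟨(Finset.range k).image e, fun x y hE j hj =>
    hE (e j) (Finset.mem_image_of_mem _ (Finset.mem_range.2 hj)) (he ▸ mem_range_self j)⟩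

/-- Adding a clopen set to the topology amounts to adding a coordinate. -/
theorem _root_.GoodFor.agreeOn_insert {φ : Ω → ℕ → Bool} {X W : Set Ω} {𝒟 : Set (Set Ω)}
    {𝒜 : Set (Ω × (ℕ → Set Ω))} (he : range e = I) {i : Ω}
    (hφ : ∀ x ∈ X, ∀ j, φ x j = f x (e j)) (hW : ∀ x ∈ X, f x i = true ↔ x ∈ W)
    (h : GoodFor (fun k x y => AgreeUpTo φ k x y ∧ (x ∈ W ↔ y ∈ W)) X 𝒟 𝒜) :
    GoodFor (AgreeOn f (insert i I)) X 𝒟 𝒜 := by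
  classical
  refine h.transfer (fun k => ?_) (fun F => ?_)
  · obtain ⟨F, hF⟩ := exists_agreeUpTo_of_agreeOn (f := f) he k
    refine ⟨insert i F, fun x hx y hy hE => ⟨fun j hj => ?_, ?_⟩⟩
    · rw [hφ x hx, hφ y hy]
      exact hF x y (fun i' hi' hI => hE i' (Finset.mem_insert_of_mem hi') (Or.inr hI)) j hj
    · rw [← hW x hx, ← hW y hy, hE i (Finset.mem_insert_self _ _) (mem_insert _ _)]
  · obtain ⟨k, hk⟩ := exists_agreeOn_of_agreeUpTo (f := f) he F
    refine ⟨k, fun x hx y hy hE => ?_⟩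
    rintro i' hi' (rfl | hI)
    · rw [Bool.eq_iff_iff, hW x hx, hW y hy, hE.2]
    · refine hk x y (fun j hj => ?_) i' hi' hI
      exact ((hφ x hx j).symm.trans (hE.1 j hj)).trans (hφ y hy j)

theorem good_agreeUpTo (p : PartialSpace Ω) (he : range e = p.I) :
    GoodFor (AgreeUpTo fun x j => p.f x (e j)) p.X p.𝒟 p.𝒜 :=
  p.good.transfer
    (fun F => (exists_agreeOn_of_agreeUpTo he F).imp fun _ h x _ y _ => h x y)
    (fun k => (exists_agreeUpTo_of_agreeOn he k).imp fun _ h x _ y _ => h x y)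

end Coordinates

open Classical in
theorem exists_ge_closedDiscrete {p : PartialSpace Ω} (hp : p.IsCountable) {i : Ω} (hi : i ∉ p.I)
    {d : ℕ → Ω} (hd : ∀ n, d n ∈ p.X) {F : ℕ → Finset Ω}
    (hF : ∀ n m, AgreeOn p.f p.I (F n) (d n) (d m) → d m = d n) :
    ∃ q ≥ p, q.IsCountable ∧ i ∈ q.I ∧ range d ∈ q.𝒟 := by
  obtain ⟨e, he⟩ := hp.I.exists_eq_range p.nonempty_I
  obtain ⟨W, hW⟩ := (p.good_agreeUpTo he.symm).exists_refinement hp.X hp.𝒜 hd fun n => by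
    obtain ⟨k, hk⟩ := exists_agreeOn_of_agreeUpTo (f := p.f) he.symm (F n)
    exact ⟨k, fun m hE => hF n m (hk _ _ hE)⟩
  have hne : ∀ j ∈ p.I, j ≠ i := fun j hj h => hi (h ▸ hj)
  refine ⟨⟨p.X, insert i p.I, fun x => Function.update (p.f x) i (decide (x ∈ W)), _, p.𝒜,
    hW.agreeOn_insert he.symm (fun x _ j => ?_) (fun x _ => ?_)⟩, ?_, ?_, ?_, ?_⟩
  · rw [Function.update_of_ne (hne _ (he ▸ mem_range_self j))]
  · rw [Function.update_self, decide_eq_true_iff]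
  · exact ⟨subset_rfl, subset_insert _ _, subset_insert _ _, subset_rfl, fun x _ j hj =>
      (Function.update_of_ne (hne j hj) _ _).symm⟩
  · exact ⟨hp.X, hp.I.insert _, hp.𝒟.insert _, hp.𝒜⟩
  · exact mem_insert _ _
  · exact mem_insert _ _

theorem exists_ge_coordinate {p : PartialSpace Ω} (hp : p.IsCountable) (i : Ω) :
    ∃ q ≥ p, q.IsCountable ∧ i ∈ q.I := by
  by_cases hi : i ∈ p.I
  · exact ⟨p, le_rfl, hp, hi⟩
  · obtain ⟨x, hx⟩ := p.good.nonempty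
    -- Only the new coordinate is wanted; a constant sequence is trivially discrete.
    obtain ⟨q, hq, hqc, hiq, -⟩ := exists_ge_closedDiscrete hp hi (d := fun _ => x) (fun _ => hx)
      (F := fun _ => ∅) (fun _ _ _ => rfl)
    exact ⟨q, hq, hqc, hiq⟩

open Classical in
theorem exists_ge_insert_point {p : PartialSpace Ω} (hp : p.IsCountable) {e : ℕ → Ω}
    (he : range e = p.I) {x : ℕ → Ω} {A : ℕ → Set Ω}
    (hxA : ∀ n, x n ∈ A n) (hAX : ∀ n, A n ⊆ p.X) (hAi : ∀ n, (A n).Infinite)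
    (hAc : ∀ n, CrowdedFor (AgreeUpTo fun x j => p.f x (e j)) (A n))
    (hAn : ∀ n, NowhereDenseFor (AgreeUpTo fun x j => p.f x (e j)) p.X (A n)) {g : ℕ → Bool}
    (hg : ∀ k m, ∃ n ≥ m, ∀ j < k, p.f (x n) (e j) = g j)
    (hgX : ∀ q ∈ p.X, (fun j => p.f q (e j)) ≠ g) {t i : Ω} (ht : t ∉ p.X) (hi : i ∉ p.I) :
    ∃ q ≥ p, q.IsCountable ∧ t ∈ q.X ∧ (t, A) ∈ q.𝒜 := by
  obtain ⟨G, hG⟩ := (p.good_agreeUpTo he).exists_insert_point hp.X hp.𝒟 hxA hAX hAi hAc hAn hg hgX ht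
  have hne : ∀ j ∈ p.I, j ≠ i := fun j hj h => hi (h ▸ hj)
  -- The enumeration `e` may repeat; `g` still takes one value per coordinate, since its finite
  -- pieces are copied from actual points.
  have hgc : ∃ γ : Ω → Bool, ∀ j, γ (e j) = g j := by
    refine ⟨fun o => if h : ∃ j, e j = o then g h.choose else false, fun j => ?_⟩
    have h : ∃ j', e j' = e j := ⟨j, rfl⟩
    refine (dif_pos h).trans ?_
    obtain ⟨n, -, hn⟩ := hg (max h.choose j + 1) 0
    rw [← hn _ (Nat.lt_succ_of_le (le_max_left _ _)), ← hn _ (Nat.lt_succ_of_le (le_max_right _ _)),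
      h.choose_spec]
  obtain ⟨γ, hγ⟩ := hgc
  refine ⟨⟨insert t p.X, insert i p.I, fun x => Function.update (Function.update p.f t γ x) i
    (decide (x ∈ G)), p.𝒟, insert (t, A) p.𝒜,
    hG.agreeOn_insert he (fun x _ j => ?_) (fun x _ => ?_)⟩, ?_, ?_, ?_, ?_⟩
  · rw [Function.update_of_ne (hne _ (he ▸ mem_range_self j))]
    by_cases hx : x = t
    · rw [hx, Function.update_self, Function.update_self, hγ]
    · rw [Function.update_of_ne hx, Function.update_of_ne hx]
  · rw [Function.update_self, decide_eq_true_iff]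
  · refine ⟨subset_insert _ _, subset_insert _ _, subset_rfl, subset_insert _ _, fun x hx j hj => ?_⟩
    change p.f x j = Function.update (Function.update p.f t γ x) i _ j
    have hxt : x ≠ t := fun h => ht (h ▸ hx)
    rw [Function.update_of_ne (hne j hj), Function.update_of_ne hxt]
  · exact ⟨hp.X.insert _, hp.I.insert _, hp.𝒟, hp.𝒜.insert _⟩
  · exact mem_insert _ _
  · exact mem_insert _ _

theorem _root_.Set.Countable.exists_notMem_of_uncountable [Uncountable Ω] {s : Set Ω}
    (hs : s.Countable) : ∃ x, x ∉ s := by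
  by_contra! h
  exact not_countable_univ (hs.mono fun x _ => h x)

theorem exists_ge_mem [Uncountable Ω] {p : PartialSpace Ω} (hp : p.IsCountable) (t : Ω) :
    ∃ q ≥ p, q.IsCountable ∧ t ∈ q.X := by
  by_cases ht : t ∈ p.X
  · exact ⟨p, le_rfl, hp, ht⟩
  obtain ⟨e, he⟩ := hp.I.exists_eq_range p.nonempty_I
  obtain ⟨i, hi⟩ := hp.I.exists_notMem_of_uncountable
  have hgood := p.good_agreeUpTo he.symm
  obtain ⟨z, hz, g, hg, hgX⟩ := exists_cluster_notMem hgood.separated hgood.crowded hp.X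
    hgood.nonempty
  choose A hAX hzA _ hAi hAc hAn using fun n =>
    exists_crowded_nowhereDense hgood.separated hgood.crowded hp.X (hz n) 0
  obtain ⟨q, hq, hqc, htq, -⟩ :=
    exists_ge_insert_point hp he.symm hzA hAX hAi hAc hAn hg hgX ht hi
  exact ⟨q, hq, hqc, htq⟩

/-- If the cluster point is already realized in `p.X`, only a promise is added; otherwise a new
point is placed there. -/
theorem exists_ge_accumulation [Uncountable Ω] {p : PartialSpace Ω} (hp : p.IsCountable)
    {x : ℕ → Ω} (hx : ∀ n, x n ∈ p.X) {F : ℕ → Finset Ω} (hF : ∀ n, ↑(F n) ⊆ p.I) :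
    ∃ q ≥ p, q.IsCountable ∧
      ∃ a ∈ q.𝒜, ∀ n, ∀ y ∈ a.2 n, AgreeOn q.f q.I (F n) (x n) y := by
  obtain ⟨e, he⟩ := hp.I.exists_eq_range p.nonempty_I
  have hgood := p.good_agreeUpTo he.symm
  choose k hk using fun n => exists_agreeOn_of_agreeUpTo (f := p.f) he.symm (F n)
  choose A hAX hxA hAk hAi hAc hAn using fun n =>
    exists_crowded_nowhereDense hgood.separated hgood.crowded hp.X (hx n) (k n)
  obtain ⟨g, hg⟩ := exists_cluster_sequence fun n j => p.f (x n) (e j)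
  have hAF : ∀ q ≥ p, ∀ n, ∀ y ∈ A n, AgreeOn q.f q.I (F n) (x n) y := fun q hq n y hy =>
    (agreeOn_iff_of_le hq (fun i hi _ => hF n hi) (hx n) (hAX n hy)).2 (hk n _ _ (hAk n y hy))
  by_cases hgX : ∃ q ∈ p.X, (fun j => p.f q (e j)) = g
  · obtain ⟨q, hq, rfl⟩ := hgX
    have hA : AccumulationFor (AgreeOn p.f p.I) p.X q A :=
      AccumulationFor.transfer (E := AgreeUpTo fun x j => p.f x (e j))
        ⟨hq, hAX, fun n => hp.X.mono (hAX n), hAi, hAc, hAn, fun k m => by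
          obtain ⟨n, hn, h⟩ := hg k m
          exact ⟨n, hn, x n, hxA n, fun j hj => (h j hj).symm⟩⟩
        (fun k => (exists_agreeUpTo_of_agreeOn he.symm k).imp fun _ h x _ y _ => h x y)
        (fun F => (exists_agreeOn_of_agreeUpTo he.symm F).imp fun _ h x _ y _ => h x y)
    let p' : PartialSpace Ω := ⟨p.X, p.I, p.f, p.𝒟, insert (q, A) p.𝒜, p.good.nonempty,
      p.good.separated, p.good.crowded, p.good.closedDiscrete, by
        rintro a (rfl | ha)
        · exact hA
        · exact p.good.accumulation a ha⟩
    have hp' : p ≤ p' :=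
      ⟨subset_rfl, subset_rfl, subset_rfl, subset_insert _ _, fun _ _ _ _ => rfl⟩
    exact ⟨p', hp', ⟨hp.X, hp.I, hp.𝒟, hp.𝒜.insert _⟩, (q, A), mem_insert _ _, hAF p' hp'⟩
  · push Not at hgX
    obtain ⟨i, hi⟩ := hp.I.exists_notMem_of_uncountable
    obtain ⟨t, ht⟩ := hp.X.exists_notMem_of_uncountable
    obtain ⟨q, hq, hqc, -, hqA⟩ :=
      exists_ge_insert_point hp he.symm hxA hAX hAi hAc hAn hg hgX ht hi
    exact ⟨q, hq, hqc, (t, A), hqA, hAF q hq⟩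

/-- The partial spaces that decide the sequence `x` with basic neighbourhoods given by `F`. -/
def Decides (x : ℕ → Ω) (F : ℕ → Finset Ω) (q : PartialSpace Ω) : Prop :=
  (∀ n, x n ∈ q.X) ∧ (∀ n, ↑(F n) ⊆ q.I) ∧
    (∃ a ∈ q.𝒜, ∀ n, ∀ y ∈ a.2 n, AgreeOn q.f q.I (F n) (x n) y) ∧
    ((∀ n m, AgreeOn q.f q.I (F n) (x n) (x m) → x m = x n) → range x ∈ q.𝒟)

theorem exists_ge_decides [Uncountable Ω] {p : PartialSpace Ω} (hp : p.IsCountable)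
    (x : ℕ → Ω) (F : ℕ → Finset Ω) : ∃ q ≥ p, q.IsCountable ∧ q.Decides x F := by
  obtain ⟨p₁, hp₁, h₁⟩ := exists_ge_forall_mem (P := {p : PartialSpace Ω // p.IsCountable})
    exists_countable_upper_bound (D := fun n => {q | x n ∈ q.1.X})
    (fun n _ _ h h' => h.1 h')
    (fun n q => by
      obtain ⟨r, hr, hrc, hx⟩ := exists_ge_mem q.2 (x n)
      exact ⟨⟨r, hrc⟩, hr, hx⟩) ⟨p, hp⟩
  have : ∃ c : ℕ → Ω, ∀ n, ↑(F n) ⊆ range c := by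
    have hc : (⋃ n, (F n : Set Ω)).Countable := countable_iUnion fun n => (F n).countable_toSet
    obtain ⟨c, hc⟩ := (hc.insert (x 0)).exists_eq_range (insert_nonempty _ _)
    exact ⟨c, fun n => hc ▸ (subset_iUnion (fun n => (F n : Set Ω)) n).trans (subset_insert _ _)⟩
  obtain ⟨c, hc⟩ := this
  obtain ⟨p₂, hp₂, h₂⟩ := exists_ge_forall_mem (P := {p : PartialSpace Ω // p.IsCountable})
    exists_countable_upper_bound (D := fun n => {q | c n ∈ q.1.I})
    (fun n _ _ h h' => h.2.1 h')
    (fun n q => by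
      obtain ⟨r, hr, hrc, hx⟩ := exists_ge_coordinate q.2 (c n)
      exact ⟨⟨r, hrc⟩, hr, hx⟩) p₁
  have hx₂ : ∀ n, x n ∈ p₂.1.X := fun n => hp₂.1 (h₁ n)
  have hF₂ : ∀ n, ↑(F n) ⊆ p₂.1.I := fun n i hi => by
    obtain ⟨m, rfl⟩ := hc n hi
    exact h₂ m
  obtain ⟨p₃, hp₃, hc₃, a, ha, haF⟩ := exists_ge_accumulation p₂.2 hx₂ hF₂
  have hp₃' : p ≤ p₃ := (show p ≤ p₁.1 from hp₁).trans ((show p₁.1 ≤ p₂.1 from hp₂).trans hp₃)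
  have hx₃ : ∀ n, x n ∈ p₃.X := fun n => hp₃.1 (hx₂ n)
  have hF₃ : ∀ n, ↑(F n) ⊆ p₃.I := fun n => (hF₂ n).trans hp₃.2.1
  -- All points `x n` and coordinates in `F n` are now present, so extensions cannot change the
  -- answer.
  by_cases hd : ∀ n m, AgreeOn p₃.f p₃.I (F n) (x n) (x m) → x m = x n
  · obtain ⟨i, hi⟩ := hc₃.I.exists_notMem_of_uncountable
    obtain ⟨q, hq, hqc, -, hqd⟩ := exists_ge_closedDiscrete hc₃ hi hx₃ hd
    refine ⟨q, hp₃'.trans hq, hqc, fun n => hq.1 (hx₃ n), fun n => (hF₃ n).trans hq.2.1,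
      ⟨a, hq.2.2.2.1 ha, fun n y hy => ?_⟩, fun _ => hqd⟩
    exact (agreeOn_iff_of_le hq (fun i hi _ => hF₃ n hi) (hx₃ n)
      ((p₃.good.accumulation a ha).subset n hy)).2 (haF n y hy)
  · exact ⟨p₃, hp₃', hc₃, hx₃, hF₃, ⟨a, ha, haF⟩, fun h => (hd h).elim⟩

/-- Under the continuum hypothesis there is a total space on a set of size `ℵ₁` that decides all
sequences. -/
theorem exists_forall_decides (CH : continuum.{0} = aleph 1) {Ω : Type} (hΩ : #Ω = aleph 1) :
    ∃ q : PartialSpace Ω, q.X = Set.univ ∧ q.I = Set.univ ∧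
      ∀ (x : ℕ → Ω) (F : ℕ → Finset Ω),
        (∃ a ∈ q.𝒜, ∀ n, ∀ y ∈ a.2 n, AgreeOn q.f Set.univ (F n) (x n) y) ∧
        ((∀ n m, AgreeOn q.f Set.univ (F n) (x n) (x m) → x m = x n) → range x ∈ q.𝒟) := by
  have hunc : Uncountable Ω := by
    rw [← Cardinal.aleph0_lt_mk_iff, hΩ]
    exact aleph0_lt_aleph_one
  -- CH enters here: there are `ℵ₁ ^ ℵ₀ = ℵ₁` requests.
  have hJ : #(ℕ → Ω × Finset Ω) ≤ aleph 1 := by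
    have h₁ : #(Finset Ω) = #Ω := Cardinal.mk_finset_of_infinite Ω
    simp only [Cardinal.mk_pi, Cardinal.mk_prod, Cardinal.lift_id, h₁, hΩ,
      Cardinal.prod_const, Cardinal.mk_nat]
    rw [← CH]
    simp
  have : Nonempty {p : PartialSpace Ω // p.IsCountable} := by
    obtain ⟨p, hp⟩ := exists_isCountable (Ω := Ω)
    exact ⟨⟨p, hp⟩⟩
  obtain ⟨G, hG, hGD⟩ := exists_directed_forall_mem
    (P := {p : PartialSpace Ω // p.IsCountable}) exists_countable_upper_bound hJ
    (D := fun j => {q | q.1.Decides (fun n => (j n).1) (fun n => (j n).2)})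
    (fun j p => by
      obtain ⟨q, hq, hqc, hD⟩ := exists_ge_decides p.2 (fun n => (j n).1) (fun n => (j n).2)
      exact ⟨⟨q, hqc⟩, hq, hD⟩)
  have : Nonempty Ω := inferInstance
  obtain ⟨q, hq, hX, hI, h𝒟, h𝒜⟩ := exists_directed_union (p := fun j => (G j).1) hG
  have hXu : q.X = Set.univ := by
    rw [eq_univ_iff_forall]
    intro x
    exact (hq fun _ => (x, ∅)).1 ((hGD fun _ => (x, ∅)).1 0)
  have hIu : q.I = Set.univ := by
    rw [eq_univ_iff_forall]
    intro i
    exact (hq fun _ => (i, {i})).2.1 ((hGD fun _ => (i, {i})).2.1 0 (Finset.mem_singleton_self i))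
  refine ⟨q, hXu, hIu, fun x F => ?_⟩
  obtain ⟨hx, hF, ⟨a, ha, haF⟩, hd⟩ := hGD fun n => (x n, F n)
  have hle := hq fun n => (x n, F n)
  have hiff : ∀ n y, y ∈ (G fun n => (x n, F n)).1.X → (AgreeOn q.f Set.univ (F n) (x n) y ↔
      AgreeOn (G fun n => (x n, F n)).1.f (G fun n => (x n, F n)).1.I (F n) (x n) y) := by
    intro n y hy
    rw [← hIu]
    exact agreeOn_iff_of_le hle (fun i hi _ => hF n hi) (hx n) hy
  refine ⟨⟨a, hle.2.2.2.1 ha, fun n y hy => ?_⟩, fun h => hle.2.2.1 (hd fun n m hE => ?_)⟩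
  · exact (hiff n y (((G fun n => (x n, F n)).1.good.accumulation a ha).subset n hy)).2
      (haF n y hy)
  · exact h n m ((hiff n _ (hx m)).2 hE)

end PartialSpace

end Partial

/-! ### The induced topology, uncountable weight, and scattered sets -/

section Topology

/-- The basic neighbourhoods given by a continuous `f` are clopen. -/
theorem isClopen_setOf_agreeOn {Ω : Type*} [TopologicalSpace Ω] {f : Ω → Ω → Bool}
    (hf : Continuous f) (F : Finset Ω) (x : Ω) : IsClopen {y | AgreeOn f Set.univ F x y} := by
  have : {y | AgreeOn f Set.univ F x y} = ⋂ i ∈ F, (fun y => f y i) ⁻¹' {f x i} := by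
    ext y
    simp [AgreeOn, eq_comm]
  rw [this]
  exact isClopen_biInter_finset fun i _ =>
    (isClopen_discrete {f x i}).preimage ((continuous_apply i).comp hf)

theorem exists_agreeOn_subset {Ω : Type*} [TopologicalSpace Ω] {f : Ω → Ω → Bool}
    (hf : Topology.IsInducing f) {U : Set Ω} (hU : IsOpen U) {x : Ω} (hx : x ∈ U) :
    ∃ F : Finset Ω, {y | AgreeOn f Set.univ F x y} ⊆ U := by
  obtain ⟨V, hV, rfl⟩ := hf.isOpen_iff.1 hU
  obtain ⟨F, u, hu, hF⟩ := isOpen_pi_iff.1 hV _ hx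
  refine ⟨F, fun y hy => hF fun i hi => ?_⟩
  rw [← hy i hi (mem_univ i)]
  exact (hu i hi).2

variable {X : Type*} [TopologicalSpace X]

/-- A crowded Hausdorff space in which countable discrete sets are closed has uncountable
weight. -/
theorem aleph_one_le_mk_of_isTopologicalBasis [T2Space X] [PerfectSpace X] [Nonempty X]
    (h : ∀ A : Set X, A.Countable → IsDiscrete A → IsClosed A) {B : Set (Set X)}
    (hB : IsTopologicalBasis B) : aleph 1 ≤ #B := by
  rw [Cardinal.aleph_one_le_iff, ← not_le, Cardinal.le_aleph0_iff_set_countable]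
  -- With a countable base, some point is the limit of a sequence of other points; the range of that
  -- sequence is discrete but not closed.
  intro hc
  have : SecondCountableTopology X := hB.secondCountableTopology hc
  obtain ⟨x⟩ := ‹Nonempty X›
  have hx : x ∈ closure ({x}ᶜ : Set X) := by
    have hacc := PerfectSpace.univ_preperfect x (mem_univ x)
    rw [accPt_iff_nhds] at hacc
    rw [mem_closure_iff_nhds]
    intro U hU
    obtain ⟨y, hy, hyx⟩ := hacc U hU
    exact ⟨y, hy.1, hyx⟩
  obtain ⟨s, hs, hlim⟩ := mem_closure_iff_seq_limit.1 hx
  have hd : IsDiscrete (range s) := by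
    rw [isDiscrete_iff_forall_mem_exists_isOpen]
    rintro _ ⟨n, rfl⟩
    obtain ⟨U, V, hU, hV, hnU, hxV, hUV⟩ := t2_separation (hs n)
    obtain ⟨N, hN⟩ := Filter.eventually_atTop.1 (hlim.eventually (hV.mem_nhds hxV))
    have hfin : ((s '' Iio N) \ {s n}).Finite := ((finite_Iio N).image s).sdiff
    refine ⟨U \ ((s '' Iio N) \ {s n}), hU.sdiff hfin.isClosed, ?_⟩
    ext y
    constructor
    · rintro ⟨⟨hyU, hy⟩, m, rfl⟩
      by_contra hne
      refine hy ⟨⟨m, ?_, rfl⟩, hne⟩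
      by_contra hm
      exact disjoint_left.1 hUV hyU (hN m (not_lt.1 hm))
    · rintro rfl
      exact ⟨⟨hnU, fun h => h.2 rfl⟩, n, rfl⟩
  have hcl := h _ (countable_range s) hd
  obtain ⟨n, hn⟩ := hcl.mem_of_tendsto hlim (Filter.Eventually.of_forall fun n => mem_range_self n)
  exact hs n hn

/-- If countable discrete sets are closed, then countable scattered sets are discrete. -/
theorem IsScatteredSet.isDiscrete (h : ∀ A : Set X, A.Countable → IsDiscrete A → IsClosed A)
    {S : Set X} (hc : S.Countable) (hS : IsScatteredSet S) : IsDiscrete S := by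
  -- The isolated points of `S` form a discrete, hence closed set; a relatively isolated point of `S
  -- \ I` would then be isolated in `S`.
  let I : Set X := {x | x ∈ S ∧ ∃ U : Set X, IsOpen U ∧ U ∩ S = {x}}
  have hIS : I ⊆ S := fun x hx => hx.1
  have hI : IsDiscrete I := by
    rw [isDiscrete_iff_forall_mem_exists_isOpen]
    rintro x ⟨hx, U, hU, hUS⟩
    refine ⟨U, hU, subset_antisymm ?_ ?_⟩
    · rw [← hUS]
      exact inter_subset_inter_right _ hIS
    · intro y hy
      obtain rfl : y = x := hy
      exact ⟨(hUS.symm ▸ mem_singleton _ : y ∈ U ∩ S).1, hx, U, hU, hUS⟩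
  have hcl := h I (hc.mono hIS) hI
  have hSI : S ⊆ I := by
    by_contra hne
    obtain ⟨y, hyS, hyI⟩ := not_subset.1 hne
    obtain ⟨x, ⟨hxS, hxI⟩, U, hU, hUx⟩ := hS (S \ I) sdiff_subset ⟨y, hyS, hyI⟩
    refine hxI ⟨hxS, U \ I, hU.sdiff hcl, ?_⟩
    rw [← hUx]
    ext z
    simp only [mem_inter_iff, mem_sdiff]
    tauto
  rwa [← hIS.antisymm hSI]

/-- For disjoint `U n`, the selected sets have a closed discrete union. Its complement meets none of
them and each `U n` meets only one, so the family is locally finite. -/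
theorem not_selectivelyPseudocompact_scatOmega [T2Space X] [Infinite X]
    (h : ∀ A : Set X, A.Countable → IsDiscrete A → IsClosed A) :
    ¬ SelectivelyPseudocompact (ScatOmega X) := by
  intro hsp
  obtain ⟨U, hUi, hUo, hU⟩ := exists_seq_infinite_isOpen_pairwise_disjoint X
  obtain ⟨A, hA, hAl⟩ := hsp U hUo fun n => (hUi n).nonempty
  refine hAl fun x => ?_
  have hd : IsDiscrete (⋃ n, A n) := by
    rw [isDiscrete_iff_forall_mem_exists_isOpen]
    intro y hy
    obtain ⟨n, hn⟩ := mem_iUnion.1 hy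
    obtain ⟨V, hV, hVA⟩ := isDiscrete_iff_forall_mem_exists_isOpen.1
      (IsScatteredSet.isDiscrete h (hA n).1.1 (hA n).1.2.2) y hn
    refine ⟨V ∩ U n, hV.inter (hUo n), ?_⟩
    rw [← hVA]
    ext z
    constructor
    · rintro ⟨⟨hzV, hzU⟩, hz⟩
      obtain ⟨m, hm⟩ := mem_iUnion.1 hz
      obtain rfl : m = n := by
        by_contra hne
        exact disjoint_left.1 (hU hne) ((hA m).2 hm) hzU
      exact ⟨hzV, hm⟩
    · exact fun hz => ⟨⟨hz.1, (hA n).2 hz.2⟩, mem_iUnion.2 ⟨n, hz.2⟩⟩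
  have hcl := h _ (countable_iUnion fun n => (hA n).1.1) hd
  by_cases hx : x ∈ ⋃ n, A n
  · obtain ⟨n, hn⟩ := mem_iUnion.1 hx
    refine ⟨U n, (hUo n).mem_nhds ((hA n).2 hn), (finite_singleton n).subset ?_⟩
    rintro m ⟨z, hzA, hzU⟩
    by_contra hne
    exact disjoint_left.1 (hU hne) ((hA m).2 hzA) hzU
  · refine ⟨(⋃ n, A n)ᶜ, hcl.isOpen_compl.mem_nhds hx, finite_empty.subset ?_⟩
    rintro m ⟨z, hzA, hz⟩
    exact (hz (mem_iUnion.2 ⟨m, hzA⟩)).elim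

end Topology

/-! ### The theorem -/

theorem exists_crowded_nwdOmega_selectivelyPseudocompact
    (CH : Cardinal.continuum.{0} = Cardinal.aleph 1) :
    ∃ (X : Type) (_ : TopologicalSpace X),
      PerfectSpace X ∧ ZeroDimensional X ∧ T2Space X ∧
      Cardinal.mk X = Cardinal.aleph 1 ∧ topWeight X = Cardinal.aleph 1 ∧
      (∀ A : Set X, A.Countable → IsDiscrete A → IsClosed A) ∧
      SelectivelyPseudocompact (NwdOmega X) := by
  obtain ⟨Ω, hΩ⟩ : ∃ Ω : Type, #Ω = aleph 1 := ⟨_, Cardinal.mk_out _⟩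
  obtain ⟨⟨X, I, f, 𝒟, 𝒜, hgood⟩, rfl, rfl, hdec⟩ :=
    PartialSpace.exists_forall_decides CH hΩ
  have hinf : Infinite Ω := by
    rw [Cardinal.infinite_iff, hΩ]
    exact aleph0_le_aleph 1
  let τ : TopologicalSpace Ω := TopologicalSpace.induced f inferInstance
  have hf : Topology.IsInducing f := ⟨rfl⟩
  have hopen : ∀ F x, IsClopen {y | AgreeOn f Set.univ F x y} :=
    isClopen_setOf_agreeOn hf.continuous
  have hself : ∀ F x, x ∈ {y | AgreeOn f Set.univ F x y} := fun F x i _ _ => rfl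
  have hnhds : ∀ (U : Set Ω) (x : Ω), U ∈ nhds x →
      ∃ F : Finset Ω, {y | AgreeOn f Set.univ F x y} ⊆ U := by
    intro U x hU
    obtain ⟨V, hVU, hV, hx⟩ := mem_nhds_iff.1 hU
    exact (exists_agreeOn_subset hf hV hx).imp fun F hF => hF.trans hVU
  have hT2 : T2Space Ω := by
    refine T2Space.of_injective_continuous (f := f) (fun x y hxy => ?_) hf.continuous
    by_contra hne
    obtain ⟨F, hF⟩ := hgood.separated x (mem_univ x) y (mem_univ y) hne
    exact hF fun i _ _ => congrFun hxy i
  have hperf : PerfectSpace Ω := ⟨fun x _ => by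
    rw [accPt_iff_nhds]
    intro U hU
    obtain ⟨F, hF⟩ := hnhds U x hU
    obtain ⟨y, -, hyx, hE⟩ := hgood.crowded x (mem_univ x) F
    exact ⟨y, ⟨hF hE, mem_univ y⟩, hyx⟩⟩
  have hclosed : ∀ A : Set Ω, A.Countable → IsDiscrete A → IsClosed A := by
    intro A hA hd
    rcases A.eq_empty_or_nonempty with rfl | hne
    · exact isClosed_empty
    obtain ⟨x, rfl⟩ := hA.exists_eq_range hne
    have : ∀ n, ∃ F : Finset Ω, ∀ m, AgreeOn f Set.univ F (x n) (x m) → x m = x n := by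
      intro n
      obtain ⟨U, hU, hUx⟩ :=
        isDiscrete_iff_forall_mem_exists_isOpen.1 hd (x n) (mem_range_self n)
      have hxU : x n ∈ U := (hUx.symm ▸ mem_singleton _ : x n ∈ U ∩ range x).1
      obtain ⟨F, hF⟩ := exists_agreeOn_subset hf hU hxU
      refine ⟨F, fun m hE => ?_⟩
      have : x m ∈ U ∩ range x := ⟨hF hE, mem_range_self m⟩
      rwa [hUx] at this
    choose F hF using this
    have hcd := (hgood.closedDiscrete _ ((hdec x F).2 hF)).2
    rw [← isOpen_compl_iff, isOpen_iff_mem_nhds]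
    intro y hy
    obtain ⟨F', hF'⟩ := hcd y (mem_univ y)
    refine Filter.mem_of_superset ((hopen F' y).isOpen.mem_nhds (hself F' y)) fun z hz hzx => ?_
    exact hy (hF' z hzx hz ▸ hzx)
  have hbasis : IsTopologicalBasis
      (range fun a : Ω × Finset Ω => {y | AgreeOn f Set.univ a.2 a.1 y}) := by
    refine isTopologicalBasis_of_isOpen_of_nhds ?_ fun x U hx hU => ?_
    · rintro _ ⟨a, rfl⟩
      exact (hopen _ _).isOpen
    · obtain ⟨F, hF⟩ := exists_agreeOn_subset hf hU hx
      exact ⟨_, ⟨(x, F), rfl⟩, hself F x, hF⟩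
  refine ⟨Ω, τ, hperf, ?_, hT2, hΩ, le_antisymm ?_ ?_, hclosed, ?_⟩
  · refine isTopologicalBasis_of_isOpen_of_nhds (fun s hs => hs.isOpen) fun x U hx hU => ?_
    obtain ⟨F, hF⟩ := exists_agreeOn_subset hf hU hx
    exact ⟨{y | AgreeOn f Set.univ F x y}, hopen F x, hself F x, hF⟩
  · have hle : topWeight Ω ≤ _ := csInf_le' ⟨_, hbasis, rfl⟩
    refine hle.trans (Cardinal.mk_range_le.trans ?_)
    rw [Cardinal.mk_prod, Cardinal.lift_id, Cardinal.lift_id, Cardinal.mk_finset_of_infinite, hΩ,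
      Cardinal.mul_eq_self (aleph0_le_aleph 1)]
  · refine le_csInf ⟨_, _, hbasis, rfl⟩ ?_
    rintro _ ⟨B, hB, rfl⟩
    exact aleph_one_le_mk_of_isTopologicalBasis hclosed hB
  · intro U hUo hUn
    choose x hx using hUn
    choose F hF using fun n => exists_agreeOn_subset hf (hUo n) (hx n)
    obtain ⟨⟨q, A⟩, ha, haF⟩ := (hdec x F).1
    have hA := hgood.accumulation _ ha
    refine ⟨A, fun n => ⟨⟨hA.countable n, hA.infinite n, ?_⟩, fun y hy => hF n (haF n y hy)⟩,
      fun hl => ?_⟩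
    · rw [IsNowhereDense, eq_empty_iff_forall_notMem]
      intro y hy
      obtain ⟨F₁, hF₁⟩ := exists_agreeOn_subset hf isOpen_interior hy
      obtain ⟨z, -, hz, F₂, hF₂⟩ := hA.nowhereDense n y (mem_univ y) F₁
      obtain ⟨w, hw, hwA⟩ := mem_closure_iff.1 (interior_subset (hF₁ hz)) _ (hopen F₂ z).isOpen
        (hself F₂ z)
      exact hF₂ w hwA hw
    · obtain ⟨V, hV, hfin⟩ := hl q
      obtain ⟨F₁, hF₁⟩ := hnhds V q hV
      obtain ⟨m, hm⟩ := hfin.bddAbove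
      obtain ⟨n, hn, y, hy, hE⟩ := hA.accumulates F₁ (m + 1)
      have := hm (show n ∈ {n | (A n ∩ V).Nonempty} from ⟨y, hy, hF₁ hE⟩)
      omega

theorem mainTheorem4 (CH : Cardinal.continuum.{0} = Cardinal.aleph 1) :
    (∃ (X : Type) (_ : TopologicalSpace X),
      PerfectSpace X ∧ ZeroDimensional X ∧ T2Space X ∧
      Cardinal.mk X = Cardinal.aleph 1 ∧ topWeight X = Cardinal.aleph 1 ∧
      (∀ A : Set X, A.Countable → IsDiscrete A → IsClosed A) ∧
      SelectivelyPseudocompact (NwdOmega X)) ∧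
    (∃ (X : Type) (_ : TopologicalSpace X),
      PerfectSpace X ∧ ZeroDimensional X ∧ T2Space X ∧
      SelectivelyPseudocompact (NwdOmega X) ∧
      ¬ SelectivelyPseudocompact (ScatOmega X)) := by
  have h := exists_crowded_nwdOmega_selectivelyPseudocompact CH
  refine ⟨h, ?_⟩
  obtain ⟨X, τ, hperf, hzero, hT2, hcard, -, hclosed, hsp⟩ := h
  have : Infinite X := by
    rw [Cardinal.infinite_iff, hcard]
    exact aleph0_le_aleph 1
  exact ⟨X, τ, hperf, hzero, hT2, hsp, not_selectivelyPseudocompact_scatOmega hclosed⟩
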